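/- Let $H_1,H_2,U$ be complex Hilbert spaces, with $U$ identified with its dual. Let $A_i:H_i\supseteq D(A_i)\to H_i$ ($i=1,2$) be positive self-adjoint operators ($\langle A_ix,x\rangle>0$ for $0\ne x\in D(A_i)$). Put $H_{i,1}=D(A_i)$ and $H_{i,1/2}=D(A_i^{1/2})$ with the norm $\|z\|_{i,1/2}=\|A_i^{1/2}z\|_{H_i}$, let $H_{i,-1/2}$ be the (anti)dual of $H_{i,1/2}$ with pivot space $H_i$, and extend $A_i$ to an operator $H_{i,1/2}\to H_{i,-1/2}$ by $\langle A_ix,\varphi\rangle=\langle A_i^{1/2}x,A_i^{1/2}\varphi\rangle$. Let $B:U\to H_{1,-1/2}$ be bounded, with adjoint $B^*:H_{1,1/2}\to U$, and let $C:H_2\supseteq D(C)\to H_1$ be a linear operator such that, with continuous embeddings (domains with graph norms), $$H_{1,1/2}\hookrightarrow D(C^*),\qquad H_{2,1/2}\hookrightarrow D(C).$$ **(a)** In $H=H_1\times H_2$ let $$A\begin{pmatrix}u\\v\end{pmatrix}=\begin{pmatrix}A_1u+C(C^*u+A_2^{1/2}v)\\A_2^{1/2}(C^*u+A_2^{1/2}v)\end{pmatrix},\qquad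 D(A)=\{(u,v)\in H_{1,1}\times H_{2,1/2}:\ C^*u+A_2^{1/2}v\in H_{2,1/2}\}.$$ Then $A$ is positive self-adjoint, every $(\varphi,\psi)\in D(A^{1/2})$ has $\varphi\in H_{1,1/2}$, $\mathcal B_0=\binom{B}{0}$, i.e. $(\mathcal B_0u)(\varphi,\psi)=(Bu)(\varphi)$, is a bounded operator from $U$ to the dual $D(A^{1/2})^*$ ($D(A^{1/2})$ with norm $\|A^{1/2}\cdot\|$), and the system $$\ddot W+AW+\mathcal B_0\mathcal B_0^*\dot W=0,\qquad W(0)=W^0,\ \dot W(0)=W^1$$ is well-posed in the energy space $D(A^{1/2})\times H$. That is: - if $W^0,W^1\in D(A^{1/2})$ and $AW^0+\mathcal B_0\mathcal B_0^*W^1\in H$, there is a unique solution $W\in C^1([0,T];D(A^{1/2}))\cap C^2([0,T];H)$ for all $T>0$, the equation holding in $D(A^{1/2})^*$ at every $t$; - for all $(W^0,W^1)\in D(A^{1/2})\times H$ there is a unique weak solution $W\in C([0,T];D(A^{1/2}))\cap C^1([0,T];H)$ for all $T>0$, i.e. $\frac{d}{dt}(\dot W+\mathcal B_0\mathcal B_0^*W)+AW=0$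 in $D(A^{1/2})^*$ (tested against each element of $D(A^{1/2})$), and $\mathcal B_0^*W\in H^1(0,T;U)$; - for each $T>0$ there is $M$ with $\|W(t)\|_{D(A^{1/2})}+\|\dot W(t)\|_H\le M(\|W^0\|_{D(A^{1/2})}+\|W^1\|_H)$ on $[0,T]$ for all weak solutions. **(b)** Consequently the coupled system $$\ddot w_1+A_1w_1+BB^*\dot w_1+C\dot w_2=0,\qquad \ddot w_2+A_2w_2-C^*\dot w_1=0,\qquad w_i(0)=w_i^0,\ \dot w_i(0)=w_i^1\quad(i=1,2)$$ is well-posed in $\mathcal H=H_{1,1/2}\times H_{2,1/2}\times H_1\times H_2$. That is: - (i) if $(w_1^0,w_2^0,w_1^1,w_2^1)\in D(\mathcal A_1)=\{(u_1,v_1,u_2,v_2)\in H_{1,1/2}\times H_{2,1}\times H_{1,1/2}\times H_{2,1/2}:\ A_1u_1+BB^*u_2\in H_1\}$, there is a unique solution $w_i\in C^1([0,T];H_{i,1/2})\cap C^2([0,T];H_i)$, $i=1,2$, for all $T>0$, the first equation holding in $H_{1,-1/2}$ and the second in $H_2$ (with $w_2(t)\in D(A_2)$) at every $t$; - (ii)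 for all $(w_1^0,w_2^0,w_1^1,w_2^1)\in\mathcal H$ there is a unique weak solution $w_i\in C([0,T];H_{i,1/2})\cap C^1([0,T];H_i)$, $i=1,2$, for all $T>0$, i.e. $\frac{d}{dt}(\dot w_1+BB^*w_1+Cw_2)+A_1w_1=0$ in $H_{1,-1/2}$ and $\frac{d}{dt}(\dot w_2-C^*w_1)+A_2w_2=0$ in $H_{2,-1/2}$ (tested against each element of $H_{i,1/2}$), and $B^*w_1\in H^1(0,T;U)$; - for each $T>0$ there is $M$ such that all weak solutions satisfy, on $[0,T]$, $\|w_1(t)\|_{1,1/2}+\|w_2(t)\|_{2,1/2}+\|\dot w_1(t)\|_{H_1}+\|\dot w_2(t)\|_{H_2}\le M(\|w_1^0\|_{1,1/2}+\|w_2^0\|_{2,1/2}+\|w_1^1\|_{H_1}+\|w_2^1\|_{H_2})$. -/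

import Mathlib

open MeasureTheory Set
open scoped ContDiff InnerProductSpace

noncomputable section

namespace CoupledSystem

/-! ### Positive self-adjoint operators and their square roots -/

section Operators

variable {H : Type*} [NormedAddCommGroup H] [InnerProductSpace ℂ H] [CompleteSpace H]

/-- `A` is densely defined, self-adjoint, and `⟨A x, x⟩ > 0` for every `x ≠ 0` in its domain. -/
structure IsPositiveSelfAdjoint (A : H →ₗ.[ℂ] H) : Prop where
  dense : Dense (A.domain : Set H)
  selfAdjoint : IsSelfAdjoint A
  pos : ∀ x : A.domain, (x : H) ≠ 0 → 0 < (⟪A x, (x : H)⟫_ℂ).re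

/-- `S` is a nonnegative self-adjoint operator with `S ∘ S = A`, domains included:
`x ∈ D(A)` iff `x ∈ D(S)` and `S x ∈ D(S)`, and then `A x = S (S x)`. -/
structure IsSquareRoot (S A : H →ₗ.[ℂ] H) : Prop where
  dense : Dense (S.domain : Set H)
  selfAdjoint : IsSelfAdjoint S
  nonneg : ∀ x : S.domain, 0 ≤ (⟪S x, (x : H)⟫_ℂ).re
  sq : ∀ x y : H, (x, y) ∈ A.graph ↔ ∃ z : H, (x, z) ∈ S.graph ∧ (z, y) ∈ S.graph

open Classical in
/-- The square root `A^{1/2}`: the (unique) nonnegative self-adjoint operator whose square is `A`.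
It exists for every nonnegative self-adjoint `A`; for other `A` the value is `0`. -/
def sqrtOp (A : H →ₗ.[ℂ] H) : H →ₗ.[ℂ] H :=
  if h : ∃ S : H →ₗ.[ℂ] H, IsSquareRoot S A then h.choose else 0

/-! ### The space `H_{1/2} = D(A^{1/2})`, with norm `‖A^{1/2} z‖`, and its dual `H_{-1/2}` -/

/-- The vector space `D(A^{1/2})`. It is a type of its own because it carries the norm
`‖A^{1/2} z‖` and not the norm of `H`. -/
def HalfSpace (A : H →ₗ.[ℂ] H) : Type _ := (sqrtOp A).domain

namespace HalfSpace

variable (A : H →ₗ.[ℂ] H)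

instance : AddCommGroup (HalfSpace A) := inferInstanceAs (AddCommGroup (sqrtOp A).domain)

instance : Module ℂ (HalfSpace A) := inferInstanceAs (Module ℂ (sqrtOp A).domain)

/-- The inclusion of `H_{1/2}` in `H`. -/
def incl : HalfSpace A →ₗ[ℂ] H := (sqrtOp A).domain.subtype

instance : CoeOut (HalfSpace A) H := ⟨fun x => incl A x⟩

/-- `A^{1/2}` as a linear map from `H_{1/2}` to `H`. -/
def root : HalfSpace A →ₗ[ℂ] H := (sqrtOp A).toFun

instance : SeminormedAddCommGroup (HalfSpace A) :=
  SeminormedAddCommGroup.induced (HalfSpace A) H (root A)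

instance : NormedSpace ℂ (HalfSpace A) := NormedSpace.induced ℂ (HalfSpace A) H (root A)

theorem norm_def (x : HalfSpace A) : ‖x‖ = ‖root A x‖ := rfl

theorem incl_mem (x : HalfSpace A) : (x : H) ∈ (sqrtOp A).domain := Subtype.property x

variable {A}

/-- An element of the domain of `A^{1/2}`, as a point of `H_{1/2}`. -/
def mk (x : H) (hx : x ∈ (sqrtOp A).domain) : HalfSpace A := ⟨x, hx⟩

end HalfSpace

/-- `H_{-1/2}`, the space of bounded antilinear functionals on `H_{1/2}`. A vector `h` of `H` is
identified with the functional `φ ↦ ⟨φ, h⟩` (the inner product is antilinear on the left), and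
`A` extends to the map that sends `x ∈ H_{1/2}` to `φ ↦ ⟨A^{1/2} φ, A^{1/2} x⟩`. -/
abbrev HalfDual (A : H →ₗ.[ℂ] H) : Type _ := HalfSpace A →L⋆[ℂ] ℂ

/-- The extension of `A` to `H_{1/2} → H_{-1/2}`, evaluated: `⟨A^{1/2} φ, A^{1/2} x⟩`. -/
def form (A : H →ₗ.[ℂ] H) (φ x : HalfSpace A) : ℂ := ⟪HalfSpace.root A φ, HalfSpace.root A x⟫_ℂ

/-- The adjoint `B* : H_{1/2} → U` of a bounded `B : U → H_{-1/2}`, the space `U` being identified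
with its dual: `⟨B* φ, u⟩ = (B u) φ`. -/
def dualAdjoint {U : Type*} [NormedAddCommGroup U] [InnerProductSpace ℂ U] [CompleteSpace U]
    {A : H →ₗ.[ℂ] H} (B : U →L[ℂ] HalfDual A) : HalfSpace A →L[ℂ] U :=
  ((InnerProductSpace.toDual ℂ U).symm : StrongDual ℂ U →L⋆[ℂ] U).comp B.flip

theorem inner_dualAdjoint {U : Type*} [NormedAddCommGroup U] [InnerProductSpace ℂ U]
    [CompleteSpace U] {A : H →ₗ.[ℂ] H} (B : U →L[ℂ] HalfDual A) (φ : HalfSpace A) (u : U) :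
    ⟪dualAdjoint B φ, u⟫_ℂ = B u φ :=
  InnerProductSpace.toDual_symm_apply

/-- The continuous embedding `H_{1/2} ↪ D(C)`, where `D(C)` has the graph norm. -/
def EmbedsInDomain {K : Type*} [NormedAddCommGroup K] [InnerProductSpace ℂ K]
    (A : H →ₗ.[ℂ] H) (C : H →ₗ.[ℂ] K) : Prop :=
  ∃ c : ℝ, ∀ x : HalfSpace A, ∃ hx : (x : H) ∈ C.domain,
    ‖(x : H)‖ + ‖C ⟨(x : H), hx⟩‖ ≤ c * ‖x‖

/-- The restriction of `C` to `H_{1/2} ⊆ D(C)`. -/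
def restrictHalf {K : Type*} [NormedAddCommGroup K] [InnerProductSpace ℂ K]
    {A : H →ₗ.[ℂ] H} {C : H →ₗ.[ℂ] K} (h : EmbedsInDomain A C) : HalfSpace A →ₗ[ℂ] K :=
  C.toFun.comp ((HalfSpace.incl A).codRestrict C.domain fun x => (h.choose_spec x).choose)

theorem restrictHalf_apply {K : Type*} [NormedAddCommGroup K] [InnerProductSpace ℂ K]
    {A : H →ₗ.[ℂ] H} {C : H →ₗ.[ℂ] K} (h : EmbedsInDomain A C) (x : HalfSpace A)
    (hx : (x : H) ∈ C.domain) : restrictHalf h x = C ⟨(x : H), hx⟩ := rfl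

end Operators

/-! ### Function spaces on `[0, T]` -/

/-- `f ∈ C¹([0,T]; E)` with derivative `f'` (one-sided at the end points). -/
structure IsC1 {E : Type*} [SeminormedAddCommGroup E] [NormedSpace ℂ E] (T : ℝ) (f f' : ℝ → E) :
    Prop where
  deriv : ∀ t ∈ Icc 0 T, HasDerivWithinAt f (f' t) (Icc 0 T) t
  cont : ContinuousOn f' (Icc 0 T)

/-- `f ∈ H¹(0,T; U)`: `f` and its weak derivative are square integrable on `(0, T)`. -/
def InH1 {U : Type*} [NormedAddCommGroup U] [InnerProductSpace ℂ U] (T : ℝ) (f : ℝ → U) : Prop :=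
  MemLp f 2 (volume.restrict (Ioo 0 T)) ∧
  ∃ g : ℝ → U, MemLp g 2 (volume.restrict (Ioo 0 T)) ∧
    ∀ φ : ℝ → ℝ, ContDiff ℝ ∞ φ → HasCompactSupport φ → tsupport φ ⊆ Ioo 0 T →
      ∫ t in Ioo 0 T, deriv φ t • f t = - ∫ t in Ioo 0 T, φ t • g t

/-! ### The second order system `Ẅ + A W + 𝓑 𝓑* Ẇ = 0` -/

section Wave

variable {H U : Type*} [NormedAddCommGroup H] [InnerProductSpace ℂ H] [CompleteSpace H]
  [NormedAddCommGroup U] [InnerProductSpace ℂ U] [CompleteSpace U]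

/-- `W ∈ C¹([0,T]; D(A^{1/2})) ∩ C²([0,T]; H)`, with first and second derivatives `V` and `Z`,
solves `Ẅ + A W + 𝓑 𝓑* Ẇ = 0` in `D(A^{1/2})*` at every `t ∈ [0,T]`, and `W(0) = W₀`,
`Ẇ(0) = W₁`. -/
structure IsStrongWave (A : H →ₗ.[ℂ] H) (𝓑 : U →L[ℂ] HalfDual A) (T : ℝ) (W₀ W₁ : HalfSpace A)
    (W V : ℝ → HalfSpace A) (Z : ℝ → H) : Prop where
  c1 : IsC1 T W V
  c2 : IsC1 T (fun t => (V t : H)) Z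
  init₀ : W 0 = W₀
  init₁ : V 0 = W₁
  eqn : ∀ t ∈ Icc 0 T, ∀ φ : HalfSpace A,
    ⟪(φ : H), Z t⟫_ℂ + form A φ (W t) + 𝓑 (dualAdjoint 𝓑 (V t)) φ = 0

/-- `W ∈ C([0,T]; D(A^{1/2})) ∩ C¹([0,T]; H)`, with derivative `V` in `H`, solves
`d/dt (Ẇ + 𝓑 𝓑* W) + A W = 0` in `D(A^{1/2})*`, and `W(0) = W₀`, `Ẇ(0) = W₁`. -/
structure IsWeakWave (A : H →ₗ.[ℂ] H) (𝓑 : U →L[ℂ] HalfDual A) (T : ℝ) (W₀ : HalfSpace A)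
    (W₁ : H) (W : ℝ → HalfSpace A) (V : ℝ → H) : Prop where
  c0 : ContinuousOn W (Icc 0 T)
  c1 : IsC1 T (fun t => (W t : H)) V
  init₀ : W 0 = W₀
  init₁ : V 0 = W₁
  eqn : ∀ t ∈ Icc 0 T, ∀ φ : HalfSpace A,
    HasDerivWithinAt (fun s => ⟪(φ : H), V s⟫_ℂ + 𝓑 (dualAdjoint 𝓑 (W s)) φ)
      (-form A φ (W t)) (Icc 0 T) t

/-- Well-posedness of `Ẅ + A W + 𝓑 𝓑* Ẇ = 0` in the energy space `D(A^{1/2}) × H`. -/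
structure WaveWellPosed (A : H →ₗ.[ℂ] H) (𝓑 : U →L[ℂ] HalfDual A) : Prop where
  /-- Data with `W₀, W₁ ∈ D(A^{1/2})` and `A W₀ + 𝓑 𝓑* W₁ ∈ H` have a unique strong solution. -/
  strong : ∀ W₀ W₁ : HalfSpace A,
    (∃ h : H, ∀ φ : HalfSpace A, form A φ W₀ + 𝓑 (dualAdjoint 𝓑 W₁) φ = ⟪(φ : H), h⟫_ℂ) →
    ∃ (W V : ℝ → HalfSpace A) (Z : ℝ → H), ∀ T > 0, IsStrongWave A 𝓑 T W₀ W₁ W V Z ∧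
      ∀ (W' V' : ℝ → HalfSpace A) (Z' : ℝ → H), IsStrongWave A 𝓑 T W₀ W₁ W' V' Z' →
        EqOn W' W (Icc 0 T)
  /-- All data in the energy space have a unique weak solution. -/
  weak : ∀ (W₀ : HalfSpace A) (W₁ : H),
    ∃ (W : ℝ → HalfSpace A) (V : ℝ → H), ∀ T > 0, IsWeakWave A 𝓑 T W₀ W₁ W V ∧
      InH1 T (fun t => dualAdjoint 𝓑 (W t)) ∧
      ∀ (W' : ℝ → HalfSpace A) (V' : ℝ → H), IsWeakWave A 𝓑 T W₀ W₁ W' V' →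
        EqOn W' W (Icc 0 T)
  /-- The solution depends continuously on the data. -/
  bound : ∀ T > 0, ∃ M : ℝ, ∀ (W₀ : HalfSpace A) (W₁ : H) (W : ℝ → HalfSpace A) (V : ℝ → H),
    IsWeakWave A 𝓑 T W₀ W₁ W V → ∀ t ∈ Icc 0 T, ‖W t‖ + ‖V t‖ ≤ M * (‖W₀‖ + ‖W₁‖)

end Wave

/-! ### The coupled system -/

section Coupled

variable {H₁ H₂ U : Type*}
  [NormedAddCommGroup H₁] [InnerProductSpace ℂ H₁] [CompleteSpace H₁]
  [NormedAddCommGroup H₂] [InnerProductSpace ℂ H₂] [CompleteSpace H₂]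
  [NormedAddCommGroup U] [InnerProductSpace ℂ U] [CompleteSpace U]

/-- The graph of the operator
`(u, v) ↦ (A₁ u + C (C* u + A₂^{1/2} v), A₂^{1/2} (C* u + A₂^{1/2} v))` on its natural domain. Here
`a = A₁ u`, `x = C* u`, `y = A₂^{1/2} v`, `b = C (x + y)`. -/
def blockGraph (A₁ : H₁ →ₗ.[ℂ] H₁) (A₂ : H₂ →ₗ.[ℂ] H₂) (C : H₂ →ₗ.[ℂ] H₁) :
    Submodule ℂ (WithLp 2 (H₁ × H₂) × WithLp 2 (H₁ × H₂)) where
  carrier := {p | ∃ (a b : H₁) (x y : H₂), (p.1.fst, a) ∈ A₁.graph ∧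
    (p.1.fst, x) ∈ C.adjoint.graph ∧ (p.1.snd, y) ∈ (sqrtOp A₂).graph ∧
    (x + y, b) ∈ C.graph ∧ (x + y, p.2.snd) ∈ (sqrtOp A₂).graph ∧ p.2.fst = a + b}
  zero_mem' := ⟨0, 0, 0, 0, A₁.graph.zero_mem, C.adjoint.graph.zero_mem,
    (sqrtOp A₂).graph.zero_mem, by simp,
    by simp, by simp⟩
  add_mem' := by
    rintro p q ⟨a, b, x, y, h1, h2, h3, h4, h5, h6⟩ ⟨a', b', x', y', k1, k2, k3, k4, k5, k6⟩
    have e : x + x' + (y + y') = x + y + (x' + y') := by abel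
    refine ⟨a + a', b + b', x + x', y + y', A₁.graph.add_mem h1 k1,
      C.adjoint.graph.add_mem h2 k2, (sqrtOp A₂).graph.add_mem h3 k3, ?_, ?_, ?_⟩
    · rw [e]; exact C.graph.add_mem h4 k4
    · rw [e]; exact (sqrtOp A₂).graph.add_mem h5 k5
    · change p.2.fst + q.2.fst = _
      rw [h6, k6]; abel
  smul_mem' := by
    rintro c p ⟨a, b, x, y, h1, h2, h3, h4, h5, h6⟩
    refine ⟨c • a, c • b, c • x, c • y, A₁.graph.smul_mem c h1,
      C.adjoint.graph.smul_mem c h2, (sqrtOp A₂).graph.smul_mem c h3, ?_, ?_, ?_⟩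
    · rw [← smul_add]; exact C.graph.smul_mem c h4
    · rw [← smul_add]; exact (sqrtOp A₂).graph.smul_mem c h5
    · change c • p.2.fst = _
      rw [h6, smul_add]

/-- The operator `A` on `H₁ × H₂`,
`A (u, v) = (A₁ u + C (C* u + A₂^{1/2} v), A₂^{1/2} (C* u + A₂^{1/2} v))`. -/
def blockOp (A₁ : H₁ →ₗ.[ℂ] H₁) (A₂ : H₂ →ₗ.[ℂ] H₂) (C : H₂ →ₗ.[ℂ] H₁) :
    WithLp 2 (H₁ × H₂) →ₗ.[ℂ] WithLp 2 (H₁ × H₂) :=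
  (blockGraph A₁ A₂ C).toLinearPMap

/-- The relation that defines `blockOp` is single-valued, so it is the graph of `blockOp`. -/
theorem graph_blockOp (A₁ : H₁ →ₗ.[ℂ] H₁) (A₂ : H₂ →ₗ.[ℂ] H₂) (C : H₂ →ₗ.[ℂ] H₁) :
    (blockOp A₁ A₂ C).graph = blockGraph A₁ A₂ C := by
  refine Submodule.toLinearPMap_graph_eq _ ?_
  rintro p ⟨a, b, x, y, h1, h2, h3, h4, h5, h6⟩ h0
  have hf : p.1.fst = 0 := by rw [h0]; rfl
  have hs : p.1.snd = 0 := by rw [h0]; rfl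
  have ha : a = 0 := A₁.graph_fst_eq_zero_snd h1 hf
  have hx : x = 0 := C.adjoint.graph_fst_eq_zero_snd h2 hf
  have hy : y = 0 := (sqrtOp A₂).graph_fst_eq_zero_snd h3 hs
  have hb : b = 0 := C.graph_fst_eq_zero_snd h4 (by rw [hx, hy, add_zero])
  have hg : p.2.snd = 0 := (sqrtOp A₂).graph_fst_eq_zero_snd h5 (by rw [hx, hy, add_zero])
  rw [ha, hb, add_zero] at h6
  exact (WithLp.equiv 2 (H₁ × H₂)).injective (Prod.ext h6 hg)

/-- `𝓑₀ = (B, 0)` as a bounded operator from `U` to the dual of `D(A^{1/2})`, for an operator `A`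
on `H₁ × H₂`: every `(φ, ψ) ∈ D(A^{1/2})` has `φ ∈ H_{1,1/2}`, and
`(𝓑₀ u) (φ, ψ) = (B u) φ`. -/
def IsColumn {A₁ : H₁ →ₗ.[ℂ] H₁} (B : U →L[ℂ] HalfDual A₁)
    {A : WithLp 2 (H₁ × H₂) →ₗ.[ℂ] WithLp 2 (H₁ × H₂)} (𝓑₀ : U →L[ℂ] HalfDual A) : Prop :=
  ∀ Φ : HalfSpace A, ∃ hφ : (Φ : WithLp 2 (H₁ × H₂)).fst ∈ (sqrtOp A₁).domain,
    ∀ u : U, 𝓑₀ u Φ = B u (HalfSpace.mk (Φ : WithLp 2 (H₁ × H₂)).fst hφ)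

variable {A₁ : H₁ →ₗ.[ℂ] H₁} {A₂ : H₂ →ₗ.[ℂ] H₂}

/-- `(u₁, v₁, u₂, v₂) ∈ D(𝓐₁)`: `u₁, u₂ ∈ H_{1,1/2}`, `v₁ ∈ H_{2,1} = D(A₂)`, `v₂ ∈ H_{2,1/2}`, and
`A₁ u₁ + B B* u₂ ∈ H₁`. -/
def InGeneratorDomain (B : U →L[ℂ] HalfDual A₁) (u₁ : HalfSpace A₁) (v₁ : HalfSpace A₂)
    (u₂ : HalfSpace A₁) (_v₂ : HalfSpace A₂) : Prop :=
  (v₁ : H₂) ∈ A₂.domain ∧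
  ∃ h : H₁, ∀ φ : HalfSpace A₁, form A₁ φ u₁ + B (dualAdjoint B u₂) φ = ⟪(φ : H₁), h⟫_ℂ

/-- `wᵢ ∈ C¹([0,T]; H_{i,1/2}) ∩ C²([0,T]; Hᵢ)`, with first and second derivatives `vᵢ` and `zᵢ`,
solves `ẅ₁ + A₁ w₁ + B B* ẇ₁ + C ẇ₂ = 0` in `H_{1,-1/2}` and `ẅ₂ + A₂ w₂ - C* ẇ₁ = 0` in `H₂` at
every `t ∈ [0,T]`, with the given initial data. The arguments `C` and `Cs` are the operators `C`
and `C*` restricted to `H_{2,1/2}` and `H_{1,1/2}`. -/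
structure IsStrongCoupled (B : U →L[ℂ] HalfDual A₁) (C : HalfSpace A₂ →ₗ[ℂ] H₁)
    (Cs : HalfSpace A₁ →ₗ[ℂ] H₂) (T : ℝ)
    (p₁ : HalfSpace A₁) (p₂ : HalfSpace A₂) (q₁ : HalfSpace A₁) (q₂ : HalfSpace A₂)
    (w₁ : ℝ → HalfSpace A₁) (w₂ : ℝ → HalfSpace A₂) (v₁ : ℝ → HalfSpace A₁)
    (v₂ : ℝ → HalfSpace A₂) (z₁ : ℝ → H₁) (z₂ : ℝ → H₂) : Prop where
  c1₁ : IsC1 T w₁ v₁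
  c1₂ : IsC1 T w₂ v₂
  c2₁ : IsC1 T (fun t => (v₁ t : H₁)) z₁
  c2₂ : IsC1 T (fun t => (v₂ t : H₂)) z₂
  init₁ : w₁ 0 = p₁ ∧ v₁ 0 = q₁
  init₂ : w₂ 0 = p₂ ∧ v₂ 0 = q₂
  eqn₁ : ∀ t ∈ Icc 0 T, ∀ φ : HalfSpace A₁,
    ⟪(φ : H₁), z₁ t⟫_ℂ + form A₁ φ (w₁ t) + B (dualAdjoint B (v₁ t)) φ
      + ⟪(φ : H₁), C (v₂ t)⟫_ℂ = 0
  eqn₂ : ∀ t ∈ Icc 0 T, ∃ h : (w₂ t : H₂) ∈ A₂.domain,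
    z₂ t + A₂ ⟨(w₂ t : H₂), h⟩ - Cs (v₁ t) = 0

/-- `wᵢ ∈ C([0,T]; H_{i,1/2}) ∩ C¹([0,T]; Hᵢ)`, with derivative `vᵢ` in `Hᵢ`, solves
`d/dt (ẇ₁ + B B* w₁ + C w₂) + A₁ w₁ = 0` in `H_{1,-1/2}` and
`d/dt (ẇ₂ - C* w₁) + A₂ w₂ = 0` in `H_{2,-1/2}`, with the given initial data. -/
structure IsWeakCoupled (B : U →L[ℂ] HalfDual A₁) (C : HalfSpace A₂ →ₗ[ℂ] H₁)
    (Cs : HalfSpace A₁ →ₗ[ℂ] H₂) (T : ℝ)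
    (p₁ : HalfSpace A₁) (p₂ : HalfSpace A₂) (q₁ : H₁) (q₂ : H₂)
    (w₁ : ℝ → HalfSpace A₁) (w₂ : ℝ → HalfSpace A₂) (v₁ : ℝ → H₁) (v₂ : ℝ → H₂) : Prop where
  c0₁ : ContinuousOn w₁ (Icc 0 T)
  c0₂ : ContinuousOn w₂ (Icc 0 T)
  c1₁ : IsC1 T (fun t => (w₁ t : H₁)) v₁
  c1₂ : IsC1 T (fun t => (w₂ t : H₂)) v₂
  init₁ : w₁ 0 = p₁ ∧ v₁ 0 = q₁
  init₂ : w₂ 0 = p₂ ∧ v₂ 0 = q₂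
  eqn₁ : ∀ t ∈ Icc 0 T, ∀ φ : HalfSpace A₁,
    HasDerivWithinAt
      (fun s => ⟪(φ : H₁), v₁ s⟫_ℂ + B (dualAdjoint B (w₁ s)) φ + ⟪(φ : H₁), C (w₂ s)⟫_ℂ)
      (-form A₁ φ (w₁ t)) (Icc 0 T) t
  eqn₂ : ∀ t ∈ Icc 0 T, ∀ ψ : HalfSpace A₂,
    HasDerivWithinAt (fun s => ⟪(ψ : H₂), v₂ s⟫_ℂ - ⟪(ψ : H₂), Cs (w₁ s)⟫_ℂ)
      (-form A₂ ψ (w₂ t)) (Icc 0 T) t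

end Coupled

end CoupledSystem

end

open CoupledSystem

/-! The generator is never handled directly; its bounded inverse `J` is. In the energy coordinates
`a = A^{1/2} w`, `b = w'`, and with `P = A^{-1/2}`, a damped second order system reads `(J u)' = u`
with `J (a, b) = (-Q a - P b, P a)`. For the wave equation `Q = P 𝓑 𝓑* P`. For the coupled system
`P` is diagonal and `Q` also has the off-diagonal blocks `P₁ C P₂` and `-P₂ C* P₁`, which the
embeddings make bounded and which are minus each other's adjoints. The `P`-terms and the coupling
cancel in real parts, so `Re ⟨J u, u⟩ = -‖F u‖²`, where `F u` is the observation `𝓑* w` (or `B*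
w₁`). Thus `J` is dissipative, and its range is dense because `P` is symmetric and injective
(`re_inner_inverseGenerator`, `denseRange_inverseGenerator`).

Such a `J` is the inverse of a contraction generator (`Dissipative.exists_orbit`): the exponentials
of the bounded operators `(J - ε)⁻¹` converge locally uniformly as `ε → 0`. Weak solutions
correspond exactly to continuous `u` with `(J u)' = u`; these are unique and contractive. A strong
solution is `J u`, with `u` started at the initial time derivative of the state. The `H¹` regularity
of `F u` comes from `(‖J u‖²)' = -2 ‖F u‖²` and density of smooth data (`IsMild.inH1`).

The block operator factors as `L* L` with `L (u, v) = (A₁^{1/2} u, C* u + A₂^{1/2} v)`. The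
triangular `L` has an explicit bounded inverse `K` (`blockRoot`), so `K K*` is a positive injective
inverse of the block operator; this yields self-adjointness and the square root. Polar decomposition
(`exists_preimage_of_sq_eq`) then shows that elements of `D(A^{1/2})` lie in the range of `K`, with
norm control, which places their first component in `H_{1,1/2}`. The coupled system is solved by the
same abstract result applied to its own `J`, without passing through the block operator. -/

noncomputable section

open Filter Topology

namespace CoupledSystem

/-! ### Dissipative bounded operators: resolvents and exponentials -/

section Evolution

variable {X : Type*} [NormedAddCommGroup X] [InnerProductSpace ℂ X]

/-- Composition of a differentiable curve with a bounded complex-linear map. -/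
theorem hasDerivWithinAt_clm {E F : Type*} [SeminormedAddCommGroup E] [NormedSpace ℂ E]
    [SeminormedAddCommGroup F] [NormedSpace ℂ F] (L : E →L[ℂ] F) {u : ℝ → E} {u' : E}
    {s : Set ℝ} {t : ℝ} (h : HasDerivWithinAt u u' s t) :
    HasDerivWithinAt (fun r => L (u r)) (L u') s t := by
  -- `HalfSpace A` carries only a seminorm, so the rule is read off the little-o definition: the
  -- remainder of `L ∘ u` is `L` applied to the remainder of `u`.
  rw [HasDerivWithinAt, HasDerivAtFilter, hasFDerivAtFilter_iff_isLittleO] at h ⊢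
  refine Asymptotics.IsBigO.trans_isLittleO ?_ h
  refine Asymptotics.IsBigO.of_bound ‖L‖ (Eventually.of_forall fun p => ?_)
  have : L (u p.1) - L (u p.2) - (ContinuousLinearMap.toSpanSingleton ℝ (L u')) (p.1 - p.2) =
      L (u p.1 - u p.2 - (ContinuousLinearMap.toSpanSingleton ℝ u') (p.1 - p.2)) := by
    have e : ∀ (r : ℝ) (x : E), L (r • x) = r • L x := fun r x => L.map_smul (r : ℂ) x
    simp only [ContinuousLinearMap.toSpanSingleton_apply, map_sub, e]
  rw [this]
  exact L.le_opNorm _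

theorem hasDerivWithinAt_norm_sq {u : ℝ → X} {v : X} {s : Set ℝ} {t : ℝ}
    (h : HasDerivWithinAt u v s t) :
    HasDerivWithinAt (fun r => ‖u r‖ ^ 2) (2 * (⟪v, u t⟫_ℂ).re) s t := by
  have h1 := h.inner ℂ h
  have h2 := (Complex.reCLM.hasFDerivAt).comp_hasDerivWithinAt t h1
  have e1 : (⟪u t, v⟫_ℂ).re = (⟪v, u t⟫_ℂ).re := inner_re_symm (𝕜 := ℂ) _ _
  have e2 : (fun r => ‖u r‖ ^ 2) = Complex.reCLM ∘ fun r => ⟪u r, u r⟫_ℂ := by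
    funext r
    exact (inner_self_eq_norm_sq (𝕜 := ℂ) (u r)).symm
  rw [e2]
  refine h2.congr_deriv ?_
  simp [e1]
  ring

/-- A bounded operator `J` on a Hilbert space is dissipative. -/
def Dissipative (J : X →L[ℂ] X) : Prop := ∀ x, (⟪J x, x⟫_ℂ).re ≤ 0

/-- The derivative of `‖u‖²` is `2 Re ⟨u', u⟩`. The derivative `v` is left free because two cases
occur: `u' = A u` for an exponential, and `(J u)' = u` for a mild solution. -/
theorem norm_le_of_inner_deriv_nonpos {T : ℝ} {u v : ℝ → X}
    (h : ∀ t ∈ Icc 0 T, HasDerivWithinAt u (v t) (Icc 0 T) t)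
    (hre : ∀ t ∈ Icc 0 T, (⟪v t, u t⟫_ℂ).re ≤ 0) : ∀ t ∈ Icc 0 T, ‖u t‖ ≤ ‖u 0‖ := by
  have ha : AntitoneOn (fun t => ‖u t‖ ^ 2) (Icc 0 T) := by
    refine antitoneOn_of_hasDerivWithinAt_nonpos (convex_Icc 0 T)
      (fun t ht => (hasDerivWithinAt_norm_sq (h t ht)).continuousWithinAt)
      (f' := fun t => 2 * (⟪v t, u t⟫_ℂ).re) ?_ ?_
    · intro t ht
      exact (hasDerivWithinAt_norm_sq (h t (interior_subset ht))).mono interior_subset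
    · intro t ht
      have := hre t (interior_subset ht)
      linarith
  intro t ht
  have := ha ⟨le_rfl, ht.1.trans ht.2⟩ ht ht.1
  exact (sq_le_sq₀ (norm_nonneg _) (norm_nonneg _)).1 this

variable [CompleteSpace X]

/-- Lax–Milgram for `J - ε`, whose real part is at most `-ε`. The inverse `G` serves as a bounded
dissipative approximation of the generator `J⁻¹`. -/
theorem Dissipative.exists_resolvent {J : X →L[ℂ] X} (hJ : Dissipative J) {ε : ℝ} (hε : 0 < ε) :
    ∃ G : X →L[ℂ] X, (∀ x, J (G x) - (ε : ℂ) • G x = x) ∧ (∀ x, G (J x) - (ε : ℂ) • G x = x) ∧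
      (∀ x, ε * ‖G x‖ ≤ ‖x‖) ∧ Dissipative G := by
  have hre : ∀ x, (⟪(J - (ε : ℂ) • (1 : X →L[ℂ] X)) x, x⟫_ℂ).re ≤ -(ε * ‖x‖ ^ 2) := by
    intro x
    have h1 : (⟪(J - (ε : ℂ) • (1 : X →L[ℂ] X)) x, x⟫_ℂ).re =
        (⟪J x, x⟫_ℂ).re - ε * ‖x‖ ^ 2 := by
      simp [inner_self_eq_norm_sq_to_K, ← Complex.ofReal_pow]
    linarith [hJ x]
  have hu : IsUnit (J - (ε : ℂ) • (1 : X →L[ℂ] X)) := by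
    refine ContinuousLinearMap.isUnit_of_forall_le_norm_inner_map _ (c := ⟨ε, hε.le⟩) hε fun x => ?_
    have h2 := Complex.abs_re_le_norm ⟪(J - (ε : ℂ) • (1 : X →L[ℂ] X)) x, x⟫_ℂ
    have h3 := neg_le_abs (⟪(J - (ε : ℂ) • (1 : X →L[ℂ] X)) x, x⟫_ℂ).re
    have h4 := hre x
    change ‖x‖ ^ 2 * ε ≤ _
    linarith
  obtain ⟨g, hg⟩ := hu
  have e1 : ∀ x, J ((g⁻¹ : (X →L[ℂ] X)ˣ).val x) - (ε : ℂ) • (g⁻¹ : (X →L[ℂ] X)ˣ).val x = x := by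
    intro x
    have := congrArg (fun L : X →L[ℂ] X => L x) g.mul_inv
    simpa [hg] using this
  have e2 : ∀ x, (g⁻¹ : (X →L[ℂ] X)ˣ).val (J x) - (ε : ℂ) • (g⁻¹ : (X →L[ℂ] X)ˣ).val x = x := by
    intro x
    have := congrArg (fun L : X →L[ℂ] X => L x) g.inv_mul
    simpa [hg] using this
  -- The coercivity estimate taken at `G x`; both the norm bound and the dissipativity of `G` follow
  -- from it.
  have e3 : ∀ x, ε * ‖(g⁻¹ : (X →L[ℂ] X)ˣ).val x‖ ^ 2 ≤
      -(⟪x, (g⁻¹ : (X →L[ℂ] X)ˣ).val x⟫_ℂ).re := by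
    intro x
    have h1 := hre ((g⁻¹ : (X →L[ℂ] X)ˣ).val x)
    have h2 : (J - (ε : ℂ) • (1 : X →L[ℂ] X)) ((g⁻¹ : (X →L[ℂ] X)ˣ).val x) = x := by
      simpa using e1 x
    rw [h2] at h1
    linarith
  refine ⟨(g⁻¹ : (X →L[ℂ] X)ˣ).val, e1, e2, fun x => ?_, fun x => ?_⟩
  · have h1 := e3 x
    have h2 := (neg_le_abs _).trans ((Complex.abs_re_le_norm
      ⟪x, (g⁻¹ : (X →L[ℂ] X)ˣ).val x⟫_ℂ).trans (norm_inner_le_norm _ _))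
    rcases (norm_nonneg ((g⁻¹ : (X →L[ℂ] X)ˣ).val x)).eq_or_lt with h0 | h0
    · rw [← h0]; simp
    · refine le_of_mul_le_mul_right ?_ h0
      nlinarith
  · have h1 := e3 x
    have h2 : 0 ≤ ε * ‖(g⁻¹ : (X →L[ℂ] X)ˣ).val x‖ ^ 2 := by positivity
    have h3 := inner_re_symm (𝕜 := ℂ) x ((g⁻¹ : (X →L[ℂ] X)ˣ).val x)
    simp only [RCLike.re_to_complex] at h3
    linarith

theorem hasDerivAt_exp_apply (A : X →L[ℂ] X) (x : X) (t : ℝ) :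
    HasDerivAt (fun s : ℝ => NormedSpace.exp (s • A) x) (A (NormedSpace.exp (t • A) x)) t := by
  have h := hasDerivAt_exp_smul_const' (𝕂 := ℝ) A t
  have h2 := hasDerivWithinAt_clm (ContinuousLinearMap.apply ℂ X x) h.hasDerivWithinAt (s := univ)
  simpa using h2

theorem Dissipative.norm_exp_apply_le {A : X →L[ℂ] X} (hA : Dissipative A) (x : X) {t : ℝ}
    (ht : 0 ≤ t) : ‖NormedSpace.exp (t • A) x‖ ≤ ‖x‖ := by
  have := norm_le_of_inner_deriv_nonpos (T := t) (u := fun s => NormedSpace.exp (s • A) x)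
    (v := fun s => A (NormedSpace.exp (s • A) x))
    (fun s _ => (hasDerivAt_exp_apply A x s).hasDerivWithinAt) (fun s _ => hA _) t ⟨ht, le_rfl⟩
  simpa using this

/-- For commuting operators, `exp ((t - s) A) exp (s A')` joins the two exponentials as `s` runs
from `0` to `t`. Its derivative in `s` is a product of contractions applied to `(A' - A) x`. -/
theorem Dissipative.norm_exp_sub_exp_le {A A' : X →L[ℂ] X} (hA : Dissipative A)
    (hA' : Dissipative A') (hc : Commute A A') (x : X) {t : ℝ} (ht : 0 ≤ t) :
    ‖NormedSpace.exp (t • A') x - NormedSpace.exp (t • A) x‖ ≤ ‖A' x - A x‖ * t := by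
  have he : ∀ s : ℝ, NormedSpace.exp (s • (A' - A)) * NormedSpace.exp (t • A) =
      NormedSpace.exp ((t - s) • A) * NormedSpace.exp (s • A') := by
    intro s
    let : NormedAlgebra ℚ (X →L[ℂ] X) := NormedAlgebra.restrictScalars ℚ ℂ _
    rw [← NormedSpace.exp_add_of_commute, ← NormedSpace.exp_add_of_commute]
    · congr 1; module
    · exact (hc.smul_left _).smul_right _
    · exact ((hc.symm.sub_left (Commute.refl A)).smul_left _).smul_right _
  have hd : ∀ s ∈ Icc 0 t, HasDerivWithinAt
      (fun s : ℝ => NormedSpace.exp (s • (A' - A)) (NormedSpace.exp (t • A) x))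
      ((A' - A) (NormedSpace.exp (s • (A' - A)) (NormedSpace.exp (t • A) x))) (Icc 0 t) s :=
    fun s _ => (hasDerivAt_exp_apply _ _ _).hasDerivWithinAt
  have hb : ∀ s ∈ Ico 0 t,
      ‖(A' - A) (NormedSpace.exp (s • (A' - A)) (NormedSpace.exp (t • A) x))‖ ≤ ‖A' x - A x‖ := by
    intro s hs
    let : NormedAlgebra ℚ (X →L[ℂ] X) := NormedAlgebra.restrictScalars ℚ ℂ _
    have h1 : (A' - A) * (NormedSpace.exp (s • (A' - A)) * NormedSpace.exp (t • A)) =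
        NormedSpace.exp ((t - s) • A) * NormedSpace.exp (s • A') * (A' - A) := by
      rw [he s]
      have c1 : Commute (A' - A) A := hc.symm.sub_left (Commute.refl A)
      have c2 : Commute (A' - A) A' := (Commute.refl A').sub_left hc
      exact ((c1.smul_right _).exp_right).mul_right ((c2.smul_right _).exp_right)
    have h2 := congrArg (fun L : X →L[ℂ] X => L x) h1
    simp only [mul_apply_eq_comp] at h2
    rw [h2]
    exact (hA.norm_exp_apply_le _ (sub_nonneg.2 hs.2.le)).trans
      ((hA'.norm_exp_apply_le _ hs.1).trans_eq (by simp))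
  have h := norm_image_sub_le_of_norm_deriv_le_segment' hd hb t ⟨ht, le_rfl⟩
  have h3 := congrArg (fun L : X →L[ℂ] X => L x) (he t)
  simp only [mul_apply_eq_comp] at h3
  rw [h3] at h
  simpa using h

end Evolution

/-! ### The contraction semigroup whose generator has inverse `J` -/

section Evolution

variable {X : Type*} [NormedAddCommGroup X] [InnerProductSpace ℂ X]

theorem commute_of_resolvent {J G G' : X →L[ℂ] X} {ε ε' : ℂ}
    (h1 : ∀ x, J (G x) - ε • G x = x) (h2 : ∀ x, G (J x) - ε • G x = x)
    (h1' : ∀ x, J (G' x) - ε' • G' x = x) (h2' : ∀ x, G' (J x) - ε' • G' x = x) :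
    Commute G G' := by
  have hGJ : ∀ x, G (J x) = J (G x) := fun x => by
    rw [← sub_left_inj (a := ε • G x), h1, h2]
  refine ContinuousLinearMap.ext fun x => ?_
  change G (G' x) = G' (G x)
  conv_rhs => rw [← h1' x, map_sub, map_smul, hGJ]
  rw [map_sub, map_smul, h2']

/-- On the range of `J²` the operator `G` differs from `J⁻¹` by `O(ε)`: since `G J = 1 + ε G`, the
error is `ε G J w = ε (w + ε G w)`. -/
theorem norm_resolvent_sub_le {J G : X →L[ℂ] X} {ε : ℝ} (hε : 0 ≤ ε)
    (h2 : ∀ x, G (J x) - (ε : ℂ) • G x = x) (h3 : ∀ x, ε * ‖G x‖ ≤ ‖x‖) (w : X) :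
    ‖G (J (J w)) - J w‖ ≤ 2 * ε * ‖w‖ := by
  have e1 : G (J (J w)) - J w = (ε : ℂ) • (w + (ε : ℂ) • G w) := by
    have := h2 (J w)
    have h := h2 w
    rw [sub_eq_iff_eq_add] at this h
    rw [this, h]
    abel
  rw [e1, norm_smul, Complex.norm_real, Real.norm_of_nonneg hε]
  have h4 : ‖w + (ε : ℂ) • G w‖ ≤ ‖w‖ + ‖w‖ := by
    refine (norm_add_le _ _).trans (add_le_add_right ?_ _)
    rw [norm_smul, Complex.norm_real, Real.norm_of_nonneg hε]
    exact h3 w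
  nlinarith [norm_nonneg w]

variable [CompleteSpace X]

/-- A bounded dissipative operator with dense range is the inverse of the generator of a
contraction semigroup. -/
theorem Dissipative.exists_orbit {J : X →L[ℂ] X} (hJ : Dissipative J) (hd : DenseRange J) (y : X) :
    ∃ u : ℝ → X, ContinuousOn u (Ici 0) ∧ u 0 = y ∧ (∀ t, 0 ≤ t → ‖u t‖ ≤ ‖y‖) ∧
      ∀ t, 0 ≤ t → J (u t) = J y + ∫ s in (0 : ℝ)..t, u s := by
  let ε : ℕ → ℝ := fun n => 1 / ((n : ℝ) + 1)
  have hε : ∀ n, 0 < ε n := fun n => by positivity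
  have hε0 : Tendsto ε atTop (𝓝 0) := tendsto_one_div_add_atTop_nhds_zero_nat
  choose G h1 h2 h3 h4 using fun n => hJ.exists_resolvent (hε n)
  let S : ℕ → ℝ → X := fun n t => NormedSpace.exp (t • G n) y
  have hSd : ∀ n t, HasDerivAt (S n) (G n (S n t)) t := fun n t => hasDerivAt_exp_apply (G n) y t
  have hSb : ∀ n t, 0 ≤ t → ‖S n t‖ ≤ ‖y‖ := fun n t ht => (h4 n).norm_exp_apply_le y ht
  have hcau : ∀ T, UniformCauchySeqOn S atTop (Icc 0 T) := by
    intro T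
    rw [Metric.uniformCauchySeqOn_iff]
    intro e he
    -- The range of `J²` is dense too, so `y` is replaced by some `J (J w)`, where the resolvent
    -- estimate applies; contractivity controls the replacement uniformly in `n` and `t`.
    obtain ⟨w, hw⟩ := (hd.comp hd J.continuous).exists_dist_lt y (show 0 < e / 4 by positivity)
    have hlim : Tendsto (fun n => 4 * ε n * ‖w‖ * T) atTop (𝓝 0) := by
      simpa using ((hε0.const_mul 4).mul_const ‖w‖).mul_const T
    obtain ⟨N, hN⟩ := eventually_atTop.1 (hlim.eventually_lt_const (show 0 < e / 4 by positivity))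
    refine ⟨N, fun m hm n hn t ht => ?_⟩
    have key : ∀ k, ‖S k t - NormedSpace.exp (t • G k) (J (J w))‖ ≤ e / 4 := by
      intro k
      rw [← map_sub]
      refine ((h4 k).norm_exp_apply_le _ ht.1).trans ?_
      rw [← dist_eq_norm]
      exact hw.le
    have hmid : ‖NormedSpace.exp (t • G m) (J (J w)) - NormedSpace.exp (t • G n) (J (J w))‖ ≤
        (2 * ε m * ‖w‖ + 2 * ε n * ‖w‖) * t := by
      refine ((h4 n).norm_exp_sub_exp_le (h4 m)
        (commute_of_resolvent (h1 n) (h2 n) (h1 m) (h2 m)) _ ht.1).trans ?_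
      refine mul_le_mul_of_nonneg_right ?_ ht.1
      have a1 := norm_resolvent_sub_le (hε m).le (h2 m) (h3 m) w
      have a2 := norm_resolvent_sub_le (hε n).le (h2 n) (h3 n) w
      have : G m (J (J w)) - G n (J (J w)) = (G m (J (J w)) - J w) - (G n (J (J w)) - J w) := by
        abel
      rw [this]
      exact (norm_sub_le _ _).trans (add_le_add a1 a2)
    have hle : (2 * ε m * ‖w‖ + 2 * ε n * ‖w‖) * t ≤ (2 * ε m * ‖w‖ + 2 * ε n * ‖w‖) * T := by
      have := (hε m).le
      have := (hε n).le
      exact mul_le_mul_of_nonneg_left ht.2 (by positivity)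
    have hm' := hN m hm
    have hn' := hN n hn
    rw [dist_eq_norm]
    have : S m t - S n t = (S m t - NormedSpace.exp (t • G m) (J (J w))) +
        (NormedSpace.exp (t • G m) (J (J w)) - NormedSpace.exp (t • G n) (J (J w))) -
        (S n t - NormedSpace.exp (t • G n) (J (J w))) := by abel
    rw [this]
    have b1 := norm_sub_le ((S m t - NormedSpace.exp (t • G m) (J (J w))) +
        (NormedSpace.exp (t • G m) (J (J w)) - NormedSpace.exp (t • G n) (J (J w))))
        (S n t - NormedSpace.exp (t • G n) (J (J w)))
    have b2 := norm_add_le (S m t - NormedSpace.exp (t • G m) (J (J w)))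
        (NormedSpace.exp (t • G m) (J (J w)) - NormedSpace.exp (t • G n) (J (J w)))
    have k1 := key m
    have k2 := key n
    linarith
  -- Convergence is known only for `t ≥ 0`; the value chosen at negative times plays no role.
  have hex : ∀ t, ∃ l, 0 ≤ t → Tendsto (fun n => S n t) atTop (𝓝 l) := by
    intro t
    by_cases ht : 0 ≤ t
    · obtain ⟨l, hl⟩ := cauchySeq_tendsto_of_complete ((hcau t).cauchySeq ⟨ht, le_rfl⟩)
      exact ⟨l, fun _ => hl⟩
    · exact ⟨0, fun h => absurd h ht⟩
  choose u hu using hex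
  have hunif : ∀ T, TendstoUniformlyOn S u atTop (Icc 0 T) := fun T =>
    (hcau T).tendstoUniformlyOn_of_tendsto fun t ht => hu t ht.1
  have hcontT : ∀ T, ContinuousOn u (Icc 0 T) := fun T =>
    (hunif T).continuousOn (Frequently.of_forall fun n t _ =>
      (hSd n t).continuousAt.continuousWithinAt)
  have hcont : ContinuousOn u (Ici 0) := by
    intro t ht
    have h5 := hcontT (t + 1) t ⟨ht, by linarith⟩
    refine h5.mono_of_mem_nhdsWithin ?_
    rw [← Ici_inter_Iic]
    exact inter_mem_nhdsWithin _ (Iic_mem_nhds (by linarith))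
  have hub : ∀ t, 0 ≤ t → ‖u t‖ ≤ ‖y‖ := fun t ht =>
    le_of_tendsto (hu t ht).norm (Eventually.of_forall fun n => hSb n t ht)
  refine ⟨u, hcont, ?_, hub, fun t ht => ?_⟩
  · refine tendsto_nhds_unique (hu 0 le_rfl) ?_
    simp [S]
  -- Since `(J - ε) G = 1`, the curve `(J - ε) S` has derivative `S`. The integrated identity no
  -- longer involves `G` and passes to the limit.
  · have hn : ∀ n, J (S n t) - (ε n : ℂ) • S n t =
        J y - (ε n : ℂ) • y + ∫ s in (0 : ℝ)..t, S n s := by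
      intro n
      have hder : ∀ s ∈ uIcc 0 t,
          HasDerivAt (fun r => J (S n r) - (ε n : ℂ) • S n r) (S n s) s := by
        intro s _
        have a1 := (hasDerivWithinAt_clm (J - (ε n : ℂ) • (1 : X →L[ℂ] X))
          (hSd n s).hasDerivWithinAt (s := univ)).hasDerivAt univ_mem
        have a2 : (J - (ε n : ℂ) • (1 : X →L[ℂ] X)) (G n (S n s)) = S n s := by
          simpa using h1 n (S n s)
        rw [a2] at a1
        exact a1
      have hi : IntervalIntegrable (S n) volume 0 t :=
        Continuous.intervalIntegrable
          (continuous_iff_continuousAt.2 fun s => (hSd n s).continuousAt) _ _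
      have := intervalIntegral.integral_eq_sub_of_hasDerivAt hder hi
      rw [this]
      simp [S]
    have hint : Tendsto (fun n => ∫ s in (0 : ℝ)..t, S n s) atTop
        (𝓝 (∫ s in (0 : ℝ)..t, u s)) := by
      refine intervalIntegral.tendsto_integral_filter_of_dominated_convergence (fun _ => ‖y‖)
        (Eventually.of_forall fun n => ?_) (Eventually.of_forall fun n => ?_)
        intervalIntegrable_const ?_
      · exact (continuous_iff_continuousAt.2
          fun s => (hSd n s).continuousAt).aestronglyMeasurable
      · refine ae_of_all _ fun s hs => hSb n s ?_
        rw [uIoc_of_le ht] at hs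
        exact hs.1.le
      · refine ae_of_all _ fun s hs => hu s ?_
        rw [uIoc_of_le ht] at hs
        exact hs.1.le
    have hεc : Tendsto (fun n => (ε n : ℂ)) atTop (𝓝 0) := by
      simpa [Function.comp_def] using (Complex.continuous_ofReal.tendsto 0).comp hε0
    have l1 : Tendsto (fun n => J (S n t) - (ε n : ℂ) • S n t) atTop (𝓝 (J (u t))) := by
      simpa using ((J.continuous.tendsto _).comp (hu t ht)).sub (hεc.smul (hu t ht))
    have l2 : Tendsto (fun n => J y - (ε n : ℂ) • y + ∫ s in (0 : ℝ)..t, S n s) atTop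
        (𝓝 (J y + ∫ s in (0 : ℝ)..t, u s)) := by
      simpa using ((tendsto_const_nhds (x := J y)).sub (hεc.smul_const y)).add hint
    refine tendsto_nhds_unique l1 (l2.congr fun n => (hn n).symm)

end Evolution

/-! ### Calculus on a compact time interval -/

theorem intervalIntegral_eq_integral_Ioo {E : Type*} [NormedAddCommGroup E] [NormedSpace ℝ E]
    {T : ℝ} (hT : 0 ≤ T) (f : ℝ → E) : ∫ t in (0 : ℝ)..T, f t = ∫ t in Ioo 0 T, f t := by
  rw [intervalIntegral.integral_of_le hT, integral_Ioc_eq_integral_Ioo]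

theorem hasDerivWithinAt_integral {E : Type*} [NormedAddCommGroup E] [NormedSpace ℝ E]
    [CompleteSpace E] {T : ℝ} {u : ℝ → E} (hu : ContinuousOn u (Icc 0 T)) {t : ℝ}
    (ht : t ∈ Icc 0 T) :
    HasDerivWithinAt (fun r => ∫ s in (0 : ℝ)..r, u s) (u t) (Icc 0 T) t := by
  have hT : 0 ≤ T := ht.1.trans ht.2
  -- A continuous extension to the whole line makes the two-sided fundamental theorem available at
  -- the end points as well.
  let v : ℝ → E := IccExtend hT ((Icc 0 T).domRestrict u)
  have hv : Continuous v := (continuousOn_iff_continuous_domRestrict.1 hu).Icc_extend'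
  have hvu : ∀ s ∈ Icc 0 T, v s = u s := fun s hs => by
    rw [show v s = _ from IccExtend_of_mem hT _ hs]
    rfl
  have h1 : HasDerivAt (fun r => ∫ s in (0 : ℝ)..r, v s) (v t) t :=
    hv.integral_hasStrictDerivAt 0 t |>.hasDerivAt
  rw [← hvu t ht]
  refine h1.hasDerivWithinAt.congr_of_mem (fun r hr => ?_) ht
  refine intervalIntegral.integral_congr fun s hs => ?_
  rw [uIcc_of_le hr.1] at hs
  exact (hvu s ⟨hs.1, hs.2.trans hr.2⟩).symm

/-! ### Membership in `H¹(0,T;U)` -/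

section H1

variable {U : Type*} [NormedAddCommGroup U]

theorem memLp_two_of_continuousOn {T : ℝ} {f : ℝ → U} (hf : ContinuousOn f (Icc 0 T)) :
    MemLp f 2 (volume.restrict (Ioo 0 T)) := by
  obtain ⟨c, hc⟩ := isCompact_Icc.exists_bound_of_continuousOn hf
  refine MemLp.of_bound ((hf.aestronglyMeasurable measurableSet_Icc).mono_measure
    (Measure.restrict_mono Ioo_subset_Icc_self le_rfl)) c ?_
  filter_upwards [ae_restrict_mem measurableSet_Ioo] with t ht
  exact hc t (Ioo_subset_Icc_self ht)

theorem eLpNorm_two_lt {T b : ℝ} (hT : 0 ≤ T) {f : ℝ → U} (hf : ContinuousOn f (Icc 0 T))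
    (h : ∫ t in (0 : ℝ)..T, ‖f t‖ ^ 2 < b ^ 2) (hb : 0 < b) :
    eLpNorm f 2 (volume.restrict (Ioo 0 T)) < ENNReal.ofReal b := by
  rw [intervalIntegral_eq_integral_Ioo hT] at h
  rw [(memLp_two_of_continuousOn hf).eLpNorm_eq_integral_rpow_norm two_ne_zero
    ENNReal.ofNat_ne_top]
  refine (ENNReal.ofReal_lt_ofReal_iff hb).2 ?_
  simp only [ENNReal.toReal_ofNat, Real.rpow_ofNat]
  rw [← one_div, ← Real.sqrt_eq_rpow]
  exact (Real.sqrt_lt' hb).2 h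

variable [InnerProductSpace ℂ U]

theorem integral_deriv_smul_eq_neg [CompleteSpace U] {T : ℝ} (hT : 0 ≤ T) {f g : ℝ → U}
    (hd : ∀ t ∈ Icc 0 T, HasDerivWithinAt f (g t) (Icc 0 T) t) (hg : ContinuousOn g (Icc 0 T))
    {φ : ℝ → ℝ} (hφ : ContDiff ℝ ∞ φ) (hs : tsupport φ ⊆ Ioo 0 T) :
    ∫ t in Ioo 0 T, deriv φ t • f t = - ∫ t in Ioo 0 T, φ t • g t := by
  have hf : ContinuousOn f (Icc 0 T) := fun t ht => (hd t ht).continuousWithinAt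
  have hφc : Continuous φ := hφ.continuous
  have hφ'c : Continuous (deriv φ) := hφ.continuous_deriv (by simp)
  -- The test function vanishes at `0` and `T`, which removes the boundary terms.
  have h0 : ∀ t, t ∉ Ioo 0 T → φ t = 0 := fun t ht => image_eq_zero_of_notMem_tsupport
    fun h => ht (hs h)
  have c1 : ContinuousOn (fun t => deriv φ t • f t) (Icc 0 T) := hφ'c.continuousOn.smul hf
  have c2 : ContinuousOn (fun t => φ t • g t) (Icc 0 T) := hφc.continuousOn.smul hg
  have i1 := c1.intervalIntegrable_of_Icc (μ := volume) hT
  have i2 := c2.intervalIntegrable_of_Icc (μ := volume) hT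
  have h := intervalIntegral.integral_eq_sub_of_hasDerivAt_of_le hT
    (hφc.continuousOn.smul hf) (f' := fun t => φ t • g t + deriv φ t • f t) (fun t ht => by
      have a1 : HasDerivAt φ (deriv φ t) t := (hφ.differentiable (by simp) t).hasDerivAt
      have a2 : HasDerivAt f (g t) t :=
        (hd t (Ioo_subset_Icc_self ht)).hasDerivAt (Icc_mem_nhds ht.1 ht.2)
      exact a1.smul a2) (i2.add i1)
  rw [intervalIntegral.integral_add i2 i1, Pi.smul_apply', Pi.smul_apply', h0 T (by simp), h0 0 (by simp), zero_smul, zero_smul,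
    sub_zero, intervalIntegral_eq_integral_Ioo hT, intervalIntegral_eq_integral_Ioo hT] at h
  exact eq_neg_of_add_eq_zero_right h

/-- A uniform limit of `C¹` functions whose derivatives form a fast Cauchy sequence in `L²` is in
`H¹`. -/
theorem inH1_of_tendstoUniformlyOn [CompleteSpace U] {T : ℝ} (hT : 0 < T) {f : ℝ → U}
    {F G : ℕ → ℝ → U}
    (hd : ∀ n, ∀ t ∈ Icc 0 T, HasDerivWithinAt (F n) (G n t) (Icc 0 T) t)
    (hG : ∀ n, ContinuousOn (G n) (Icc 0 T)) (hf : ContinuousOn f (Icc 0 T))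
    (hlim : TendstoUniformlyOn F f atTop (Icc 0 T))
    (hc : ∀ N n m, N ≤ n → N ≤ m →
      ∫ t in (0 : ℝ)..T, ‖G n t - G m t‖ ^ 2 < ((1 / 2 : ℝ) ^ N) ^ 2) : InH1 T f := by
  refine ⟨memLp_two_of_continuousOn hf, ?_⟩
  -- Completeness of `L²` is used for a sequence with summable Cauchy bounds, hence the geometric
  -- rate in the hypothesis.
  obtain ⟨g, hg, hgl⟩ := Lp.cauchy_complete_eLpNorm (μ := volume.restrict (Ioo 0 T)) (p := 2)
    (by norm_num) (fun n => memLp_two_of_continuousOn (hG n))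
    (B := fun N => ENNReal.ofReal ((1 / 2 : ℝ) ^ N))
    (by
      rw [← ENNReal.ofReal_tsum_of_nonneg (fun n => by positivity) summable_geometric_two]
      exact ENNReal.ofReal_ne_top)
    (fun N n m hn hm => eLpNorm_two_lt hT.le ((hG n).sub (hG m)) (hc N n m hn hm) (by positivity))
  refine ⟨g, hg, fun φ hφ hcs hs => ?_⟩
  have hφc : Continuous φ := hφ.continuous
  have hφ'c : Continuous (deriv φ) := hφ.continuous_deriv (by simp)
  have hF : ∀ n, ContinuousOn (F n) (Icc 0 T) := fun n t ht => (hd n t ht).continuousWithinAt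
  have hmono : volume.restrict (Ioo 0 T) ≤ volume.restrict (Icc (0 : ℝ) T) :=
    Measure.restrict_mono Ioo_subset_Icc_self le_rfl
  have l1 : Tendsto (fun n => ∫ t in Ioo 0 T, deriv φ t • F n t) atTop
      (𝓝 (∫ t in Ioo 0 T, deriv φ t • f t)) := by
    refine tendsto_integral_filter_of_dominated_convergence
      (fun t => ‖deriv φ t‖ * (‖f t‖ + 1)) (Eventually.of_forall fun n => ?_) ?_ ?_ ?_
    · exact ((hφ'c.continuousOn.smul (hF n)).aestronglyMeasurable measurableSet_Icc).mono_measure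
        hmono
    · filter_upwards [Metric.tendstoUniformlyOn_iff.1 hlim 1 one_pos] with n hn
      filter_upwards [ae_restrict_mem measurableSet_Ioo] with t ht
      have h1 := hn t (Ioo_subset_Icc_self ht)
      rw [norm_smul]
      refine mul_le_mul_of_nonneg_left ?_ (norm_nonneg _)
      rw [dist_comm, dist_eq_norm] at h1
      linarith [norm_le_norm_add_norm_sub' (F n t) (f t)]
    · have : ContinuousOn (fun t => ‖deriv φ t‖ * (‖f t‖ + 1)) (Icc 0 T) :=
        hφ'c.norm.continuousOn.mul (hf.norm.add continuousOn_const)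
      exact (this.integrableOn_compact isCompact_Icc).mono_set Ioo_subset_Icc_self
    · filter_upwards [ae_restrict_mem measurableSet_Ioo] with t ht
      exact (hlim.tendsto_at (Ioo_subset_Icc_self ht)).const_smul _
  -- Hölder with exponents `2, 2`: multiplication by the fixed test function turns `L²` convergence
  -- of the derivatives into `L¹` convergence.
  have l2 : Tendsto (fun n => ∫ t in Ioo 0 T, φ t • G n t) atTop
      (𝓝 (∫ t in Ioo 0 T, φ t • g t)) := by
    have hφ2 : MemLp φ 2 (volume.restrict (Ioo 0 T)) :=
      (hφc.memLp_of_hasCompactSupport hcs).restrict _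
    have hi : ∀ n, Integrable (fun t => φ t • G n t) (volume.restrict (Ioo 0 T)) := fun n =>
      memLp_one_iff_integrable.1 (MemLp.smul (φ := φ) (memLp_two_of_continuousOn (hG n)) hφ2)
    refine tendsto_integral_of_L1' _ (hφ2.1.smul hg.1)
      (Eventually.of_forall fun n => hi n) ?_
    have hb : ∀ n, eLpNorm ((fun t => φ t • G n t) - fun t => φ t • g t) 1
        (volume.restrict (Ioo 0 T)) ≤ eLpNorm φ 2 (volume.restrict (Ioo 0 T)) *
          eLpNorm (G n - g) 2 (volume.restrict (Ioo 0 T)) := by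
      intro n
      have : ((fun t => φ t • G n t) - fun t => φ t • g t) = φ • (G n - g) := by
        funext t
        simp [smul_sub]
      rw [this]
      exact eLpNorm_smul_le_mul_eLpNorm
        ((memLp_two_of_continuousOn (hG n)).1.sub hg.1) hφ2.1
    refine tendsto_of_tendsto_of_tendsto_of_le_of_le tendsto_const_nhds ?_ (fun _ => zero_le) hb
    simpa using ENNReal.Tendsto.const_mul hgl (Or.inr hφ2.2.ne)
  refine tendsto_nhds_unique l1 ?_
  refine l2.neg.congr fun n => ?_
  exact (integral_deriv_smul_eq_neg hT.le (hd n) (hG n) hφ hs).symm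

end H1

/-! ### Mild solutions: uniqueness, energy bound, hidden regularity -/

section Mild

variable {X : Type*} [NormedAddCommGroup X] [InnerProductSpace ℂ X]

/-- A continuous curve `u` on `[0, T]` with `(J u)' = u` weakly: a mild solution of `u' = J⁻¹ u`. -/
structure IsMild (J : X →L[ℂ] X) (T : ℝ) (u : ℝ → X) : Prop where
  cont : ContinuousOn u (Icc 0 T)
  weakDeriv : ∀ f, ∀ t ∈ Icc 0 T,
    HasDerivWithinAt (fun s => ⟪f, J (u s)⟫_ℂ) ⟪f, u t⟫_ℂ (Icc 0 T) t

theorem hasDerivWithinAt_inner_const {u : ℝ → X} {v : X} {s : Set ℝ} {t : ℝ}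
    (h : HasDerivWithinAt u v s t) (f : X) :
    HasDerivWithinAt (fun r => ⟪f, u r⟫_ℂ) ⟪f, v⟫_ℂ s t :=
  hasDerivWithinAt_clm (innerSL ℂ f) h

theorem isMild_of_hasDerivWithinAt {J : X →L[ℂ] X} {T : ℝ} {u : ℝ → X}
    (hc : ContinuousOn u (Icc 0 T))
    (h : ∀ t ∈ Icc 0 T, HasDerivWithinAt (fun s => J (u s)) (u t) (Icc 0 T) t) : IsMild J T u :=
  ⟨hc, fun f t ht => hasDerivWithinAt_inner_const (h t ht) f⟩

theorem IsMild.sub {J : X →L[ℂ] X} {T : ℝ} {u v : ℝ → X} (hu : IsMild J T u)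
    (hv : IsMild J T v) : IsMild J T (fun t => u t - v t) where
  cont := hu.cont.sub hv.cont
  weakDeriv f t ht := by
    have h := (hu.weakDeriv f t ht).sub (hv.weakDeriv f t ht)
    rw [← inner_sub_right] at h
    refine h.congr_of_mem (fun s _ => ?_) ht
    rw [map_sub, inner_sub_right]
    rfl

variable [CompleteSpace X]

/-- A weak derivative that is continuous is a strong one: tested against any `f`, `J u` minus the
integral of `u` has zero derivative, so it is constant. -/
theorem IsMild.hasDerivWithinAt {J : X →L[ℂ] X} {T : ℝ} {u : ℝ → X} (hu : IsMild J T u) :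
    ∀ t ∈ Icc 0 T, HasDerivWithinAt (fun s => J (u s)) (u t) (Icc 0 T) t := by
  have key : ∀ t ∈ Icc 0 T, J (u t) = J (u 0) + ∫ s in (0 : ℝ)..t, u s := by
    intro t ht
    refine ext_inner_left ℂ fun f => ?_
    have hd : ∀ s ∈ Icc 0 T, HasDerivWithinAt
        (fun r => ⟪f, J (u r)⟫_ℂ - ⟪f, ∫ s in (0 : ℝ)..r, u s⟫_ℂ) 0 (Icc 0 T) s := by
      intro s hs
      have := (hu.weakDeriv f s hs).sub
        (hasDerivWithinAt_inner_const (hasDerivWithinAt_integral hu.cont hs) f)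
      rwa [sub_self] at this
    have := norm_image_sub_le_of_norm_deriv_le_segment' hd (C := 0) (by simp) t ht
    rw [zero_mul, norm_le_zero_iff, sub_eq_zero] at this
    simp only [intervalIntegral.integral_same, inner_zero_right, sub_zero] at this
    rw [inner_add_right, ← this]
    ring
  intro t ht
  exact ((hasDerivWithinAt_integral hu.cont ht).const_add (J (u 0))).congr_of_mem key ht

theorem IsMild.map {J : X →L[ℂ] X} {T : ℝ} {u : ℝ → X} (hu : IsMild J T u) :
    IsMild J T (fun t => J (u t)) :=
  isMild_of_hasDerivWithinAt (fun t ht => (hu.hasDerivWithinAt t ht).continuousWithinAt)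
    fun t ht => hasDerivWithinAt_clm J (hu.hasDerivWithinAt t ht)

/-- The curve `u` need not be differentiable, but `J u` is, with derivative `u`, so dissipativity
makes `‖J u‖` nonincreasing. It starts at zero, hence `J u = 0`, and its derivative `u` vanishes
too. -/
theorem Dissipative.eqOn_zero {J : X →L[ℂ] X} (hJ : Dissipative J) {T : ℝ} (hT : 0 < T)
    {u : ℝ → X} (hu : IsMild J T u) (h0 : u 0 = 0) : ∀ t ∈ Icc 0 T, u t = 0 := by
  have hz : ∀ t ∈ Icc 0 T, J (u t) = 0 := by
    intro t ht
    have := norm_le_of_inner_deriv_nonpos hu.hasDerivWithinAt (fun s _ => by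
      rw [← inner_conj_symm, Complex.conj_re]
      exact hJ (u s)) t ht
    simpa [h0] using this
  intro t ht
  have h1 := (hu.hasDerivWithinAt t ht).congr_of_mem (fun s hs => (hz s hs).symm) ht
  exact (uniqueDiffOn_Icc hT t ht).eq_deriv _ h1 (hasDerivWithinAt_const t _ 0)

theorem Dissipative.eqOn_of_isMild {J : X →L[ℂ] X} (hJ : Dissipative J) {T : ℝ} (hT : 0 < T)
    {u v : ℝ → X} (hu : IsMild J T u) (hv : IsMild J T v) (h0 : u 0 = v 0) :
    EqOn u v (Icc 0 T) := fun t ht =>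
  sub_eq_zero.1 (hJ.eqOn_zero hT (hu.sub hv) (sub_eq_zero.2 h0) t ht)

theorem Dissipative.exists_isMild {J : X →L[ℂ] X} (hJ : Dissipative J) (hd : DenseRange J)
    (y : X) : ∃ u : ℝ → X, u 0 = y ∧ ContinuousOn u (Ici 0) ∧ (∀ t, 0 ≤ t → ‖u t‖ ≤ ‖y‖) ∧
      ∀ T, IsMild J T u := by
  obtain ⟨u, hc, h0, hb, hi⟩ := hJ.exists_orbit hd y
  refine ⟨u, h0, hc, hb, fun T => ?_⟩
  have hcT : ContinuousOn u (Icc 0 T) := hc.mono Icc_subset_Ici_self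
  exact isMild_of_hasDerivWithinAt hcT fun t ht =>
    ((hasDerivWithinAt_integral hcT ht).const_add (J y)).congr_of_mem (fun s hs => hi s hs.1) ht

/-- The bound is known for the orbit built by approximation, and uniqueness identifies `u` with it.
-/
theorem Dissipative.norm_le_of_isMild {J : X →L[ℂ] X} (hJ : Dissipative J) (hd : DenseRange J)
    {T : ℝ} (hT : 0 < T) {u : ℝ → X} (hu : IsMild J T u) : ∀ t ∈ Icc 0 T, ‖u t‖ ≤ ‖u 0‖ := by
  intro t ht
  obtain ⟨v, h0, -, hb, hv⟩ := hJ.exists_isMild hd (u 0)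
  rw [hJ.eqOn_of_isMild hT hu (hv T) h0.symm ht]
  exact hb t ht.1

variable {U : Type*} [NormedAddCommGroup U] [InnerProductSpace ℂ U]

/-- Integrates `(‖J u‖²)' = -2 ‖F u‖²`. Only the weaker norm `‖J (u 0)‖` of the data appears on the
right, which is what `IsMild.inH1` exploits. -/
theorem IsMild.two_mul_integral_norm_sq_le {J : X →L[ℂ] X} {F : X →L[ℂ] U}
    (hJF : ∀ x, (⟪J x, x⟫_ℂ).re = -‖F x‖ ^ 2) {T : ℝ} (hT : 0 ≤ T) {u : ℝ → X}
    (hu : IsMild J T u) : 2 * ∫ t in (0 : ℝ)..T, ‖F (u t)‖ ^ 2 ≤ ‖J (u 0)‖ ^ 2 := by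
  have hc : ContinuousOn (fun t => ‖F (u t)‖ ^ 2) (Icc 0 T) :=
    (F.continuous.comp_continuousOn hu.cont).norm.pow 2
  have hd : ∀ t ∈ Icc 0 T, HasDerivWithinAt (fun t => ‖J (u t)‖ ^ 2)
      (-2 * ‖F (u t)‖ ^ 2) (Icc 0 T) t := by
    intro t ht
    refine (hasDerivWithinAt_norm_sq (hu.hasDerivWithinAt t ht)).congr_deriv ?_
    rw [← inner_conj_symm, Complex.conj_re, hJF]
    ring
  have h := intervalIntegral.integral_eq_sub_of_hasDerivAt_of_le hT
    (fun t ht => (hd t ht).continuousWithinAt)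
    (fun t ht => (hd t (Ioo_subset_Icc_self ht)).hasDerivAt (Icc_mem_nhds ht.1 ht.2))
    ((continuousOn_const.mul hc).intervalIntegrable_of_Icc hT)
  rw [intervalIntegral.integral_const_mul] at h
  nlinarith [sq_nonneg ‖J (u T)‖]

/-- Choose `z n` with `J (z n) → u 0` and let `v n` start at `z n`. Then `F (J (v n))` tends
uniformly to `F u` and has derivative `F (v n)`. The latter is Cauchy in `L²` even if `z n` has no
limit, because its differences are controlled by `‖J (z n) - J (z m)‖`. -/
theorem IsMild.inH1 [CompleteSpace U] {J : X →L[ℂ] X} {F : X →L[ℂ] U}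
    (hJF : ∀ x, (⟪J x, x⟫_ℂ).re = -‖F x‖ ^ 2) (hd : DenseRange J) {T : ℝ} (hT : 0 < T)
    {u : ℝ → X} (hu : IsMild J T u) : InH1 T (fun t => F (u t)) := by
  have hJ : Dissipative J := fun x => by rw [hJF]; simp
  -- Half of `2⁻ⁿ`, so that two such errors add up to at most `2⁻ᴺ`.
  choose z hz using fun n : ℕ =>
    hd.exists_dist_lt (u 0) (show 0 < (1 / 2 : ℝ) ^ n / 2 by positivity)
  choose v hv0 hvc hvb hv using fun n => hJ.exists_isMild hd (z n)
  have huv : ∀ n, ∀ t ∈ Icc 0 T, ‖u t - J (v n t)‖ ≤ (1 / 2 : ℝ) ^ n / 2 := by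
    intro n t ht
    have := hJ.norm_le_of_isMild hd hT (hu.sub (hv n T).map) t ht
    refine this.trans ?_
    rw [hv0, ← dist_eq_norm]
    exact (hz n).le
  refine inH1_of_tendstoUniformlyOn hT (F := fun n t => F (J (v n t))) (G := fun n t => F (v n t))
    (fun n t ht => hasDerivWithinAt_clm F ((hv n T).hasDerivWithinAt t ht))
    (fun n => F.continuous.comp_continuousOn (hv n T).cont)
    (F.continuous.comp_continuousOn hu.cont) ?_ ?_
  · rw [Metric.tendstoUniformlyOn_iff]
    intro e he
    have hl : Tendsto (fun n : ℕ => ‖F‖ * ((1 / 2 : ℝ) ^ n / 2)) atTop (𝓝 0) := by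
      simpa using ((tendsto_pow_atTop_nhds_zero_of_lt_one (r := (1 / 2 : ℝ)) (by norm_num)
        (by norm_num)).div_const 2).const_mul ‖F‖
    filter_upwards [hl.eventually_lt_const he] with n hn t ht
    rw [dist_eq_norm, ← map_sub]
    refine (F.le_opNorm _).trans_lt (lt_of_le_of_lt ?_ hn)
    exact mul_le_mul_of_nonneg_left (huv n t ht) (norm_nonneg _)
  · intro N n m hn hm
    have h1 := ((hv n T).sub (hv m T)).two_mul_integral_norm_sq_le hJF hT.le
    simp only [map_sub] at h1
    rw [hv0, hv0] at h1
    have h2 : ‖J (z n) - J (z m)‖ ≤ (1 / 2 : ℝ) ^ N := by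
      have a1 := (hz n).le
      have a2 := (hz m).le
      rw [dist_comm] at a1
      have a3 := dist_triangle (J (z n)) (u 0) (J (z m))
      have b1 : (1 / 2 : ℝ) ^ n ≤ (1 / 2) ^ N :=
        pow_le_pow_of_le_one (by norm_num) (by norm_num) hn
      have b2 : (1 / 2 : ℝ) ^ m ≤ (1 / 2) ^ N :=
        pow_le_pow_of_le_one (by norm_num) (by norm_num) hm
      rw [← dist_eq_norm]
      linarith
    have h3 : ‖J (z n) - J (z m)‖ ^ 2 ≤ ((1 / 2 : ℝ) ^ N) ^ 2 :=
      pow_le_pow_left₀ (norm_nonneg _) h2 2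
    have h4 : 0 < ((1 / 2 : ℝ) ^ N) ^ 2 := by positivity
    linarith

end Mild

/-! ### Unbounded self-adjoint operators through their bounded inverses -/

section Unbounded

variable {H : Type*} [NormedAddCommGroup H] [InnerProductSpace ℂ H] [CompleteSpace H]

theorem mem_graph_iff_of_isSelfAdjoint {S : H →ₗ.[ℂ] H} (hS : IsSelfAdjoint S) {x y : H} :
    (x, y) ∈ S.graph ↔ ∀ a b, (a, b) ∈ S.graph → ⟪b, x⟫_ℂ = ⟪a, y⟫_ℂ := by
  have h := LinearPMap.adjoint_graph_eq_graph_adjoint hS.dense_domain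
  rw [LinearPMap.isSelfAdjoint_def.1 hS] at h
  conv_lhs => rw [h, Submodule.mem_adjoint_iff]
  simp only [sub_eq_zero]

/-- A linear relation `{(G y, y)}` with `G` bounded, symmetric and injective is the graph of a
densely defined self-adjoint operator. -/
theorem isSelfAdjoint_of_graph_eq_inverse {A : H →ₗ.[ℂ] H} {G : H →L[ℂ] H}
    (hG : ∀ x y, ⟪G x, y⟫_ℂ = ⟪x, G y⟫_ℂ) (h0 : ∀ x, G x = 0 → x = 0)
    (hA : ∀ x y, (x, y) ∈ A.graph ↔ x = G y) :
    Dense (A.domain : Set H) ∧ IsSelfAdjoint A := by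
  have hdense : Dense (A.domain : Set H) := by
    rw [Submodule.dense_iff_topologicalClosure_eq_top, Submodule.topologicalClosure_eq_top_iff,
      Submodule.eq_bot_iff]
    intro z hz
    refine h0 z (ext_inner_left ℂ fun y => ?_)
    rw [inner_zero_right, ← hG]
    obtain ⟨w, hw, -⟩ := A.mem_graph_iff.1 ((hA (G y) y).2 rfl)
    rw [← show (w : H) = G y from hw]
    exact (Submodule.mem_orthogonal _ _).1 hz w w.2
  refine ⟨hdense, LinearPMap.isSelfAdjoint_def.2 (LinearPMap.eq_of_eq_graph ?_)⟩
  rw [LinearPMap.adjoint_graph_eq_graph_adjoint hdense]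
  ext ⟨x, y⟩
  rw [hA, Submodule.mem_adjoint_iff]
  simp only [sub_eq_zero]
  constructor
  · intro h
    refine ext_inner_left ℂ fun b => ?_
    rw [h (G b) b ((hA _ _).2 rfl), hG]
  · rintro rfl a b hab
    rw [(hA _ _).1 hab, hG]

/-- The operator with graph `{(P y, y)}`. -/
def inverseOp (P : H →L[ℂ] H) : H →ₗ.[ℂ] H :=
  (LinearMap.range ((P : H →ₗ[ℂ] H).prod LinearMap.id)).toLinearPMap

omit [CompleteSpace H] in
theorem mem_graph_inverseOp {P : H →L[ℂ] H} (h0 : ∀ x, P x = 0 → x = 0) (x y : H) :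
    (x, y) ∈ (inverseOp P).graph ↔ x = P y := by
  rw [inverseOp, Submodule.toLinearPMap_graph_eq]
  · simp [eq_comm]
  · rintro _ ⟨z, rfl⟩ hz
    exact h0 z hz

/-- The bounded functional calculus suffices: the inverse of `G^{1/2}` is a square root of `A =
G⁻¹`. -/
theorem exists_isSquareRoot {A : H →ₗ.[ℂ] H} {G : H →L[ℂ] H} (hG : G.IsPositive)
    (h0 : ∀ x, G x = 0 → x = 0) (hA : ∀ x y, (x, y) ∈ A.graph ↔ x = G y) :
    ∃ S, IsSquareRoot S A := by
  have hG' : 0 ≤ G := (ContinuousLinearMap.nonneg_iff_isPositive G).2 hG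
  have hP := (ContinuousLinearMap.nonneg_iff_isPositive _).1 (CFC.sqrt_nonneg G)
  have hPP : ∀ x, CFC.sqrt G (CFC.sqrt G x) = G x := fun x => by
    conv_rhs => rw [← CFC.sqrt_mul_sqrt_self G hG']
    rfl
  have hP0 : ∀ x, CFC.sqrt G x = 0 → x = 0 := fun x hx => h0 x (by rw [← hPP, hx, map_zero])
  have hsa := isSelfAdjoint_of_graph_eq_inverse (fun x y => hP.isSymmetric x y) hP0
    (mem_graph_inverseOp hP0)
  refine ⟨inverseOp (CFC.sqrt G), hsa.1, hsa.2, fun x => ?_, fun x y => ?_⟩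
  · have hx : (x : H) = CFC.sqrt G (inverseOp (CFC.sqrt G) x) :=
      (mem_graph_inverseOp hP0 _ _).1 (LinearPMap.mem_graph _ x)
    conv_rhs => rw [hx]
    exact hP.re_inner_nonneg_right _
  · simp only [mem_graph_inverseOp hP0, hA]
    constructor
    · rintro rfl
      exact ⟨_, (hPP y).symm, rfl⟩
    · rintro ⟨z, rfl, rfl⟩
      exact hPP y

theorem sqrtOp_isSquareRoot {A : H →ₗ.[ℂ] H} (h : ∃ S, IsSquareRoot S A) :
    IsSquareRoot (sqrtOp A) A := by
  rw [sqrtOp, dif_pos h]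
  exact h.choose_spec

/-- `R` is the bounded symmetric inverse of `A^{1/2}`. -/
structure IsRootInverse (A : H →ₗ.[ℂ] H) (R : H →L[ℂ] H) : Prop where
  mem_graph : ∀ x y, (x, y) ∈ (sqrtOp A).graph ↔ x = R y
  symm : ∀ x y, ⟪R x, y⟫_ℂ = ⟪x, R y⟫_ℂ

/-- The inverse of a self-adjoint bijection is symmetric and everywhere defined, hence bounded by
Hellinger–Toeplitz. -/
theorem exists_isRootInverse_of_bijective {A : H →ₗ.[ℂ] H} (hS : IsSelfAdjoint (sqrtOp A))
    (hinj : ∀ x, (x, 0) ∈ (sqrtOp A).graph → x = 0)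
    (hsurj : ∀ y, ∃ x, (x, y) ∈ (sqrtOp A).graph) : ∃ R, IsRootInverse A R := by
  choose r hr using hsurj
  have huniq : ∀ x y, (x, y) ∈ (sqrtOp A).graph → x = r y := by
    intro x y hxy
    have := (sqrtOp A).graph.sub_mem hxy (hr y)
    rw [Prod.mk_sub_mk, sub_self] at this
    exact sub_eq_zero.1 (hinj _ this)
  let rl : H →ₗ[ℂ] H :=
    { toFun := r
      map_add' := fun y z => (huniq _ _ ((sqrtOp A).graph.add_mem (hr y) (hr z))).symm
      map_smul' := fun c y => (huniq _ _ ((sqrtOp A).graph.smul_mem c (hr y))).symm }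
  have hsymm : rl.IsSymmetric := fun y z =>
    ((mem_graph_iff_of_isSelfAdjoint hS).1 (hr z) _ _ (hr y)).symm
  refine ⟨⟨rl, hsymm.continuous⟩, fun x y => ⟨huniq x y, ?_⟩, fun x y => hsymm x y⟩
  rintro rfl
  exact hr y

theorem HalfSpace.mem_graph {A : H →ₗ.[ℂ] H} (x : HalfSpace A) :
    ((x : H), HalfSpace.root A x) ∈ (sqrtOp A).graph := LinearPMap.mem_graph (sqrtOp A) x

/-- If `H_{1/2}` embeds continuously in `H`, then `A^{1/2}` has a bounded inverse. That `A` has a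
square root at all is automatic: otherwise `sqrtOp A` is the everywhere defined zero operator, so the
estimate forces `H = 0`, where `0` is a square root of `A`. -/
theorem exists_isRootInverse_of_coercive {A : H →ₗ.[ℂ] H} (c : ℝ)
    (hc : ∀ x : HalfSpace A, ‖(x : H)‖ ≤ c * ‖x‖) :
    IsSquareRoot (sqrtOp A) A ∧ ∃ R, IsRootInverse A R := by
  have hbd : ∀ x y, (x, y) ∈ (sqrtOp A).graph → ‖x‖ ≤ c * ‖y‖ := by
    intro x y hxy
    obtain ⟨w, hw, hy⟩ := LinearPMap.mem_graph_iff _ |>.1 hxy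
    have : ‖(w : H)‖ ≤ c * ‖sqrtOp A w‖ := hc w
    rwa [hw, hy] at this
  have hroot : IsSquareRoot (sqrtOp A) A := by
    refine sqrtOp_isSquareRoot ?_
    by_contra hne
    have h0 : sqrtOp A = 0 := dif_neg hne
    have hz : ∀ x : H, x = 0 := by
      intro x
      have := hbd x 0 (by rw [h0]; exact LinearPMap.mem_graph_iff _ |>.2 ⟨⟨x, trivial⟩, rfl, rfl⟩)
      simpa using this
    have hsub : Subsingleton H := ⟨fun x y => by rw [hz x, hz y]⟩
    have hd : Dense (((0 : H →ₗ.[ℂ] H).domain : Submodule ℂ H) : Set H) := dense_univ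
    refine hne ⟨0, hd, ?_, fun x => ?_, fun x y => ?_⟩
    · rw [LinearPMap.isSelfAdjoint_def]
      refine LinearPMap.eq_of_eq_graph ?_
      ext ⟨x, y⟩
      rw [hz x, hz y]
      exact ⟨fun _ => zero_mem _, fun _ => zero_mem _⟩
    · rw [hz (x : H), inner_zero_right, Complex.zero_re]
    · rw [hz x, hz y]
      exact ⟨fun _ => ⟨0, zero_mem _, zero_mem _⟩, fun _ => zero_mem _⟩
  have hS := hroot.selfAdjoint
  refine ⟨hroot, exists_isRootInverse_of_bijective hS (fun x hx => by simpa using hbd x 0 hx) ?_⟩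
  -- The range of `A^{1/2}` is everything: it is closed, by the lower bound and the closed graph,
  -- and its orthogonal complement is the kernel of a self-adjoint operator, which is trivial.
  let V : Submodule ℂ H := (sqrtOp A).graph.map (LinearMap.snd ℂ H H)
  have hV : ∀ y, y ∈ V ↔ ∃ x, (x, y) ∈ (sqrtOp A).graph := by
    intro y
    simp [V, Submodule.mem_map]
  have hclosed : IsClosed (V : Set H) := by
    refine IsSeqClosed.isClosed fun y z hy hz => ?_
    choose x hx using fun n => (hV _).1 (hy n)
    have hcau : CauchySeq x := by
      rw [Metric.cauchySeq_iff']
      intro ε hε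
      -- The sign of `c` is unknown, so `|c| + 1` serves as a positive denominator.
      obtain ⟨N, hN⟩ := Metric.cauchySeq_iff'.1 hz.cauchySeq (ε / (|c| + 1)) (by positivity)
      refine ⟨N, fun n hn => ?_⟩
      have h1 := hbd _ _ ((sqrtOp A).graph.sub_mem (hx n) (hx N))
      have h2 := hN n hn
      rw [dist_eq_norm] at h2 ⊢
      rw [lt_div_iff₀ (by positivity)] at h2
      have h3 := le_abs_self c
      nlinarith [norm_nonneg (y n - y N)]
    obtain ⟨w, hw⟩ := cauchySeq_tendsto_of_complete hcau
    refine (hV z).2 ⟨w, ?_⟩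
    exact IsClosed.mem_of_tendsto (IsSelfAdjoint.isClosed hS) (hw.prodMk_nhds hz)
      (Eventually.of_forall hx)
  have hperp : Vᗮ = ⊥ := by
    rw [Submodule.eq_bot_iff]
    intro y hy
    have : (y, 0) ∈ (sqrtOp A).graph := by
      rw [mem_graph_iff_of_isSelfAdjoint hS]
      intro a b hab
      rw [inner_zero_right]
      exact (Submodule.mem_orthogonal _ _).1 hy b ((hV b).2 ⟨a, hab⟩)
    simpa using hbd _ _ this
  have htop : V = ⊤ := by
    rw [← hclosed.submodule_topologicalClosure_eq, Submodule.topologicalClosure_eq_top_iff, hperp]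
  intro y
  exact (hV y).1 (htop ▸ trivial)

namespace IsRootInverse

variable {A : H →ₗ.[ℂ] H} {R : H →L[ℂ] H}

theorem mem_domain (h : IsRootInverse A R) (y : H) : R y ∈ (sqrtOp A).domain := by
  obtain ⟨w, hw, -⟩ := LinearPMap.mem_graph_iff _ |>.1 ((h.mem_graph (R y) y).2 rfl)
  exact (show (w : H) = R y from hw) ▸ w.2

theorem root_mk (h : IsRootInverse A R) (y : H) :
    HalfSpace.root A (HalfSpace.mk (R y) (h.mem_domain y)) = y := by
  obtain ⟨w, hw, hy⟩ := LinearPMap.mem_graph_iff _ |>.1 ((h.mem_graph (R y) y).2 rfl)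
  have : HalfSpace.mk (R y) (h.mem_domain y) = w := Subtype.ext hw.symm
  rw [this]
  exact hy

theorem apply_root (h : IsRootInverse A R) (x : HalfSpace A) : R (HalfSpace.root A x) = x :=
  ((h.mem_graph _ _).1 x.mem_graph).symm

theorem injective (h : IsRootInverse A R) {x : H} (hx : R x = 0) : x = 0 :=
  (sqrtOp A).graph_fst_eq_zero_snd ((h.mem_graph 0 x).2 hx.symm) rfl

theorem root_injective (h : IsRootInverse A R) {x y : HalfSpace A}
    (hxy : HalfSpace.root A x = HalfSpace.root A y) : x = y :=
  Subtype.ext ((h.apply_root x).symm.trans ((congrArg R hxy).trans (h.apply_root y)))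

/-- The isometric isomorphism `A^{-1/2} : H → H_{1/2}`. -/
def lift (h : IsRootInverse A R) : H →L[ℂ] HalfSpace A :=
  LinearMap.mkContinuous
    { toFun := fun y => HalfSpace.mk (R y) (h.mem_domain y)
      map_add' := fun y z => Subtype.ext (map_add R y z)
      map_smul' := fun c y => Subtype.ext (map_smul R c y) } 1 fun y => by
    rw [one_mul, HalfSpace.norm_def]
    exact (congrArg norm (h.root_mk y)).le

theorem root_lift (h : IsRootInverse A R) (y : H) : HalfSpace.root A (h.lift y) = y := h.root_mk y

theorem incl_lift (h : IsRootInverse A R) (y : H) : HalfSpace.incl A (h.lift y) = R y := rfl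

theorem lift_root (h : IsRootInverse A R) (x : HalfSpace A) : h.lift (HalfSpace.root A x) = x :=
  h.root_injective (h.root_lift _)

theorem norm_lift (h : IsRootInverse A R) (y : H) : ‖h.lift y‖ = ‖y‖ := by
  rw [HalfSpace.norm_def, h.root_lift]

theorem dense_range (h : IsRootInverse A R) : DenseRange R := by
  have : Dense ((LinearMap.range (R : H →ₗ[ℂ] H) : Submodule ℂ H) : Set H) := by
    rw [Submodule.dense_iff_topologicalClosure_eq_top, Submodule.topologicalClosure_eq_top_iff,
      Submodule.eq_bot_iff]
    intro z hz
    refine h.injective (ext_inner_left ℂ fun y => ?_)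
    rw [inner_zero_right, ← h.symm]
    exact (Submodule.mem_orthogonal _ _).1 hz _ ⟨y, rfl⟩
  exact this

theorem mem_graph_sq (h : IsRootInverse A R) (hS : IsSquareRoot (sqrtOp A) A) (x y : H) :
    (x, y) ∈ A.graph ↔ x = R (R y) := by
  rw [hS.sq]
  simp only [h.mem_graph]
  constructor
  · rintro ⟨z, rfl, rfl⟩; rfl
  · rintro rfl; exact ⟨_, rfl, rfl⟩

theorem root_eq_of_mem_graph (h : IsRootInverse A R) (hS : IsSquareRoot (sqrtOp A) A)
    {x : HalfSpace A} {y : H} (hxy : ((x : H), y) ∈ A.graph) : HalfSpace.root A x = R y := by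
  have : x = h.lift (R y) := Subtype.ext ((h.mem_graph_sq hS _ _).1 hxy)
  rw [this, h.root_lift]

end IsRootInverse

/-- `A^{1/2}` as a bounded map on `H_{1/2}`. -/
def rootL (A : H →ₗ.[ℂ] H) : HalfSpace A →L[ℂ] H :=
  LinearMap.mkContinuous (HalfSpace.root A) 1 fun x => by rw [one_mul, HalfSpace.norm_def]

theorem rootL_apply (A : H →ₗ.[ℂ] H) (x : HalfSpace A) : rootL A x = HalfSpace.root A x := rfl

end Unbounded

/-! ### Hilbert sums -/

section ProdL2

variable {E F : Type*} [NormedAddCommGroup E] [InnerProductSpace ℂ E] [NormedAddCommGroup F]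
  [InnerProductSpace ℂ F]

/-- A bounded map into a Hilbert sum from its components. -/
def pairL {Z : Type*} [NormedAddCommGroup Z] [InnerProductSpace ℂ Z] (f : Z →L[ℂ] E)
    (g : Z →L[ℂ] F) : Z →L[ℂ] WithLp 2 (E × F) :=
  ((WithLp.prodContinuousLinearEquiv 2 ℂ E F).symm : E × F →L[ℂ] WithLp 2 (E × F)).comp (f.prod g)

theorem inner_prodL2 (x y : WithLp 2 (E × F)) :
    ⟪x, y⟫_ℂ = ⟪x.fst, y.fst⟫_ℂ + ⟪x.snd, y.snd⟫_ℂ := WithLp.prod_inner_apply x y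

theorem norm_toLp_le {E F : Type*} [NormedAddCommGroup E] [NormedAddCommGroup F] (a : E) (b : F) : ‖WithLp.toLp 2 (a, b)‖ ≤ ‖a‖ + ‖b‖ := by
  have := WithLp.prod_norm_sq_eq_of_L2 (WithLp.toLp 2 (a, b))
  refine (sq_le_sq₀ (norm_nonneg _) (by positivity)).1 ?_
  simp only [WithLp.toLp_fst, WithLp.toLp_snd] at this
  rw [this]
  nlinarith [norm_nonneg a, norm_nonneg b]

theorem continuousOn_toLp {E F : Type*} [NormedAddCommGroup E] [NormedAddCommGroup F] {a : ℝ → E}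
    {b : ℝ → F} {s : Set ℝ} (ha : ContinuousOn a s) (hb : ContinuousOn b s) :
    ContinuousOn (fun t => WithLp.toLp 2 (a t, b t)) s :=
  (WithLp.prod_continuous_toLp 2 E F).comp_continuousOn (ha.prodMk hb)

end ProdL2

/-! ### The inverse generator of a damped second order system -/

section BlockGenerator

variable {Y : Type*} [NormedAddCommGroup Y] [InnerProductSpace ℂ Y]

/-- The inverse `(a, b) ↦ (-Q a - P b, P a)` of the generator of a damped second order system, in
the coordinates `a = A^{1/2} w`, `b = ẇ`, with `P = A^{-1/2}`. -/
def inverseGenerator (P Q : Y →L[ℂ] Y) : WithLp 2 (Y × Y) →L[ℂ] WithLp 2 (Y × Y) :=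
  pairL (-(Q.comp (WithLp.fstL 2 ℂ Y Y)) - P.comp (WithLp.sndL 2 ℂ Y Y)) (P.comp (WithLp.fstL 2 ℂ Y Y))

theorem inverseGenerator_fst (P Q : Y →L[ℂ] Y) (x : WithLp 2 (Y × Y)) :
    (inverseGenerator P Q x).fst = -Q x.fst - P x.snd := rfl

theorem inverseGenerator_snd (P Q : Y →L[ℂ] Y) (x : WithLp 2 (Y × Y)) :
    (inverseGenerator P Q x).snd = P x.fst := rfl

variable {U : Type*} [NormedAddCommGroup U] [InnerProductSpace ℂ U] {P Q : Y →L[ℂ] Y}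
  {E : Y →L[ℂ] U}

/-- By symmetry of `P` the terms `-⟨P b, a⟩` and `⟨P a, b⟩` cancel in real parts, leaving only the
damping. -/
theorem re_inner_inverseGenerator (hP : ∀ x y, ⟪P x, y⟫_ℂ = ⟪x, P y⟫_ℂ)
    (hQ : ∀ a, (⟪Q a, a⟫_ℂ).re = ‖E a‖ ^ 2) (x : WithLp 2 (Y × Y)) :
    (⟪inverseGenerator P Q x, x⟫_ℂ).re = -‖(E.comp (WithLp.fstL 2 ℂ Y Y)) x‖ ^ 2 := by
  have h1 : (⟪P x.fst, x.snd⟫_ℂ).re = (⟪P x.snd, x.fst⟫_ℂ).re := by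
    rw [hP, ← inner_conj_symm, Complex.conj_re]
  rw [inner_prodL2, inverseGenerator_fst, inverseGenerator_snd, inner_sub_left, inner_neg_left]
  simp only [Complex.add_re, Complex.sub_re, Complex.neg_re, hQ, h1]
  change _ = -‖E x.fst‖ ^ 2
  ring

/-- For `z` orthogonal to the range, `a = 0` gives `P z.fst = 0`, and then `b = 0` gives `P z.snd =
0`. Nothing is needed from `Q`. -/
theorem denseRange_inverseGenerator [CompleteSpace Y] (hP : ∀ x y, ⟪P x, y⟫_ℂ = ⟪x, P y⟫_ℂ)
    (h0 : ∀ x, P x = 0 → x = 0) : DenseRange (inverseGenerator P Q) := by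
  have : Dense ((LinearMap.range (inverseGenerator P Q : WithLp 2 (Y × Y) →ₗ[ℂ]
      WithLp 2 (Y × Y)) : Submodule ℂ (WithLp 2 (Y × Y))) : Set (WithLp 2 (Y × Y))) := by
    rw [Submodule.dense_iff_topologicalClosure_eq_top, Submodule.topologicalClosure_eq_top_iff,
      Submodule.eq_bot_iff]
    intro z hz
    have hz' : ∀ a b, ⟪-Q a - P b, z.fst⟫_ℂ + ⟪P a, z.snd⟫_ℂ = 0 := fun a b =>
      (inner_prodL2 _ _).symm.trans
        ((Submodule.mem_orthogonal _ _).1 hz _ ⟨WithLp.toLp 2 (a, b), rfl⟩)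
    have e1 : z.fst = 0 := h0 _ (ext_inner_left ℂ fun b => by
      have := hz' 0 (-b)
      rw [← hP]
      simpa using this)
    have e2 : z.snd = 0 := h0 _ (ext_inner_left ℂ fun a => by
      have := hz' a 0
      rw [← hP]
      simpa [e1] using this)
    exact (WithLp.equiv 2 (Y × Y)).injective (Prod.ext e1 e2)
  exact this

/-- The second component says that `w = P a` has derivative `b`; the first, tested with `f = A^{1/2}
φ`, is the weak form of the second order equation. -/
theorem isMild_inverseGenerator_iff {T : ℝ} {a b : ℝ → Y} :
    IsMild (inverseGenerator P Q) T (fun t => WithLp.toLp 2 (a t, b t)) ↔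
      ContinuousOn a (Icc 0 T) ∧ ContinuousOn b (Icc 0 T) ∧
      (∀ f, ∀ t ∈ Icc 0 T, HasDerivWithinAt (fun s => ⟪f, Q (a s) + P (b s)⟫_ℂ) (-⟪f, a t⟫_ℂ)
        (Icc 0 T) t) ∧
      ∀ f, ∀ t ∈ Icc 0 T, HasDerivWithinAt (fun s => ⟪f, P (a s)⟫_ℂ) ⟪f, b t⟫_ℂ (Icc 0 T) t := by
  constructor
  · intro h
    refine ⟨(WithLp.fstL 2 ℂ Y Y).continuous.comp_continuousOn h.cont,
      (WithLp.sndL 2 ℂ Y Y).continuous.comp_continuousOn h.cont, fun f t ht => ?_, fun f t ht => ?_⟩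
    · have := (h.weakDeriv (WithLp.toLp 2 (f, 0)) t ht).neg
      simp only [inner_prodL2, inverseGenerator_fst, inverseGenerator_snd, WithLp.toLp_fst,
        WithLp.toLp_snd, inner_zero_left, add_zero] at this
      refine this.congr_of_mem (fun s _ => ?_) ht
      simp only [Pi.neg_apply, inner_sub_right, inner_neg_right, inner_add_right]
      ring
    · have := h.weakDeriv (WithLp.toLp 2 (0, f)) t ht
      simpa only [inner_prodL2, inverseGenerator_fst, inverseGenerator_snd, WithLp.toLp_fst,
        WithLp.toLp_snd, inner_zero_left, zero_add] using this
  · rintro ⟨ha, hb, h1, h2⟩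
    refine ⟨continuousOn_toLp ha hb, fun f t ht => ?_⟩
    have := (h1 f.fst t ht).neg.add (h2 f.snd t ht)
    rw [neg_neg] at this
    simp only [inner_prodL2, inverseGenerator_fst, inverseGenerator_snd, WithLp.toLp_fst,
      WithLp.toLp_snd]
    refine this.congr_of_mem (fun s _ => ?_) ht
    simp only [Pi.add_apply, Pi.neg_apply, inner_sub_right, inner_neg_right, inner_add_right]
    ring

end BlockGenerator

/-! ### Well-posedness of the damped wave equation -/

section Wave

variable {H U : Type*} [NormedAddCommGroup H] [InnerProductSpace ℂ H] [CompleteSpace H]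
  [NormedAddCommGroup U] [InnerProductSpace ℂ U] [CompleteSpace U]
  {A : H →ₗ.[ℂ] H} {R : H →L[ℂ] H}

/-- The observation operator `𝓑* A^{-1/2}`. -/
def IsRootInverse.obs (h : IsRootInverse A R) (𝓑 : U →L[ℂ] HalfDual A) : H →L[ℂ] U :=
  (dualAdjoint 𝓑).comp h.lift

/-- The damping operator `A^{-1/2} 𝓑 𝓑* A^{-1/2}`. -/
def IsRootInverse.damp (h : IsRootInverse A R) (𝓑 : U →L[ℂ] HalfDual A) : H →L[ℂ] H :=
  (ContinuousLinearMap.adjoint (h.obs 𝓑)).comp (h.obs 𝓑)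

namespace IsRootInverse

theorem obs_root (h : IsRootInverse A R) (𝓑 : U →L[ℂ] HalfDual A) (x : HalfSpace A) :
    h.obs 𝓑 (HalfSpace.root A x) = dualAdjoint 𝓑 x := by
  change dualAdjoint 𝓑 (h.lift _) = _
  rw [h.lift_root]

theorem inner_damp (h : IsRootInverse A R) (𝓑 : U →L[ℂ] HalfDual A) (φ x : HalfSpace A) :
    ⟪HalfSpace.root A φ, h.damp 𝓑 (HalfSpace.root A x)⟫_ℂ = 𝓑 (dualAdjoint 𝓑 x) φ := by
  change ⟪_, ContinuousLinearMap.adjoint (h.obs 𝓑) (h.obs 𝓑 _)⟫_ℂ = _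
  rw [ContinuousLinearMap.adjoint_inner_right, h.obs_root, h.obs_root, inner_dualAdjoint]

theorem re_inner_damp (h : IsRootInverse A R) (𝓑 : U →L[ℂ] HalfDual A) (a : H) :
    (⟪h.damp 𝓑 a, a⟫_ℂ).re = ‖h.obs 𝓑 a‖ ^ 2 := by
  change (⟪ContinuousLinearMap.adjoint (h.obs 𝓑) (h.obs 𝓑 a), a⟫_ℂ).re = _
  rw [ContinuousLinearMap.adjoint_inner_left]
  exact inner_self_eq_norm_sq (𝕜 := ℂ) _

theorem inner_root_apply (h : IsRootInverse A R) (φ : HalfSpace A) (y : H) :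
    ⟪HalfSpace.root A φ, R y⟫_ℂ = ⟪(φ : H), y⟫_ℂ := by
  rw [← h.symm, h.apply_root]

/-- Test functions `φ` of `H_{1/2}` and vectors `f = A^{1/2} φ` of `H` are in bijection, which
matches the two weak equations term by term. -/
theorem isWeakWave_iff (h : IsRootInverse A R) (𝓑 : U →L[ℂ] HalfDual A) {T : ℝ}
    {W₀ : HalfSpace A} {W₁ : H} {W : ℝ → HalfSpace A} {V : ℝ → H} :
    IsWeakWave A 𝓑 T W₀ W₁ W V ↔ IsMild (inverseGenerator R (h.damp 𝓑)) T
      (fun t => WithLp.toLp 2 (HalfSpace.root A (W t), V t)) ∧ W 0 = W₀ ∧ V 0 = W₁ := by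
  rw [isMild_inverseGenerator_iff]
  constructor
  · intro w
    refine ⟨⟨(rootL A).continuous.comp_continuousOn w.c0, w.c1.cont, fun f t ht => ?_,
      fun f t ht => ?_⟩, w.init₀, w.init₁⟩
    · have := w.eqn t ht (h.lift f)
      rw [form, h.root_lift] at this
      refine this.congr_of_mem (fun s _ => ?_) ht
      rw [inner_add_right, ← h.inner_damp, h.root_lift, ← h.inner_root_apply, h.root_lift, add_comm]
    · have := hasDerivWithinAt_inner_const (w.c1.deriv t ht) f
      simpa only [h.apply_root] using this
  · rintro ⟨⟨ha, hb, h1, h2⟩, h3, h4⟩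
    have hm := (isMild_inverseGenerator_iff (P := R) (Q := h.damp 𝓑)).2 ⟨ha, hb, h1, h2⟩
    refine ⟨?_, ⟨fun t ht => ?_, hb⟩, h3, h4, fun t ht φ => ?_⟩
    · have := h.lift.continuous.comp_continuousOn ha
      simpa only [Function.comp_def, h.lift_root] using this
    -- A norm derivative of `W` in `H` is required here, so the strong form of the mild equation is
    -- used.
    · have := hasDerivWithinAt_clm (WithLp.sndL 2 ℂ H H) (hm.hasDerivWithinAt t ht)
      simpa only [WithLp.sndL_apply, inverseGenerator_snd, WithLp.toLp_fst, WithLp.toLp_snd,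
        h.apply_root]
        using this
    · refine (h1 (HalfSpace.root A φ) t ht).congr_of_mem (fun s _ => ?_) ht
      rw [inner_add_right, h.inner_damp, h.inner_root_apply, add_comm]

theorem isWeakWave_of_isStrongWave (h : IsRootInverse A R) {𝓑 : U →L[ℂ] HalfDual A} {T : ℝ}
    {W₀ W₁ : HalfSpace A} {W V : ℝ → HalfSpace A} {Z : ℝ → H}
    (w : IsStrongWave A 𝓑 T W₀ W₁ W V Z) :
    IsWeakWave A 𝓑 T W₀ (W₁ : H) W (fun t => (V t : H)) := by
  have hc : ContinuousOn (fun t => h.lift (HalfSpace.root A (W t))) (Icc 0 T) :=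
    h.lift.continuous.comp_continuousOn fun t ht =>
      (hasDerivWithinAt_clm (rootL A) (w.c1.deriv t ht)).continuousWithinAt
  simp only [h.lift_root] at hc
  refine ⟨hc, ⟨fun t ht => ?_, fun t ht =>
    (w.c2.deriv t ht).continuousWithinAt⟩, w.init₀, by rw [w.init₁], fun t ht φ => ?_⟩
  · have := hasDerivWithinAt_clm (R.comp (rootL A)) (w.c1.deriv t ht)
    simpa only [ContinuousLinearMap.comp_apply, rootL_apply, h.apply_root] using this
  · have h1 := hasDerivWithinAt_inner_const (w.c2.deriv t ht) (φ : H)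
    have h2 := hasDerivWithinAt_inner_const (hasDerivWithinAt_clm ((h.damp 𝓑).comp (rootL A))
      (w.c1.deriv t ht)) (HalfSpace.root A φ)
    simp only [ContinuousLinearMap.comp_apply, rootL_apply, h.inner_damp] at h2
    refine (h1.add h2).congr_deriv ?_
    linear_combination w.eqn t ht φ

theorem dissipative (h : IsRootInverse A R) (𝓑 : U →L[ℂ] HalfDual A) :
    Dissipative (inverseGenerator R (h.damp 𝓑)) := fun x => by
  rw [re_inner_inverseGenerator h.symm (h.re_inner_damp 𝓑)]
  simp

theorem denseRange (h : IsRootInverse A R) (Q : H →L[ℂ] H) :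
    DenseRange (inverseGenerator R Q) :=
  denseRange_inverseGenerator h.symm fun _ => h.injective

theorem eqOn_of_isWeakWave (h : IsRootInverse A R) {𝓑 : U →L[ℂ] HalfDual A} {T : ℝ} (hT : 0 < T)
    {W₀ : HalfSpace A} {W₁ : H} {W W' : ℝ → HalfSpace A} {V V' : ℝ → H}
    (w : IsWeakWave A 𝓑 T W₀ W₁ W V) (w' : IsWeakWave A 𝓑 T W₀ W₁ W' V') :
    EqOn W' W (Icc 0 T) := by
  intro t ht
  have := (h.dissipative 𝓑).eqOn_of_isMild hT ((h.isWeakWave_iff 𝓑).1 w').1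
    ((h.isWeakWave_iff 𝓑).1 w).1 (by simp only [w.init₀, w.init₁, w'.init₀, w'.init₁]) ht
  exact h.root_injective (congrArg (fun x : WithLp 2 (H × H) => x.fst) this)

/-- Well-posedness of the damped wave equation for an operator with bounded `A^{-1/2}`. -/
theorem waveWellPosed (h : IsRootInverse A R) (𝓑 : U →L[ℂ] HalfDual A) : WaveWellPosed A 𝓑 := by
  have hd := h.dissipative 𝓑
  have hr := h.denseRange (h.damp 𝓑)
  refine ⟨?_, ?_, ?_⟩
  · rintro W₀ W₁ ⟨g, hg⟩
    -- The datum is the time derivative of the state at `0`: velocity `W₁` and acceleration `-g`.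
    -- The compatibility hypothesis says exactly that `J` sends it to `(A^{1/2} W₀, W₁)`, so `J u`
    -- is the desired state.
    obtain ⟨u, hu0, -, -, hu⟩ := hd.exists_isMild hr (WithLp.toLp 2 (HalfSpace.root A W₁, -g))
    have hstrong : ∀ T, IsStrongWave A 𝓑 T W₀ W₁
        (fun t => h.lift (inverseGenerator R (h.damp 𝓑) (u t)).fst)
        (fun t => h.lift (u t).fst) (fun t => (u t).snd) := by
      intro T
      have hc1 := (WithLp.fstL 2 ℂ H H).continuous.comp_continuousOn (hu T).cont
      refine ⟨⟨fun t ht => hasDerivWithinAt_clm (h.lift.comp (WithLp.fstL 2 ℂ H H))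
          ((hu T).hasDerivWithinAt t ht), h.lift.continuous.comp_continuousOn hc1⟩,
        ⟨fun t ht => hasDerivWithinAt_clm (WithLp.sndL 2 ℂ H H) ((hu T).hasDerivWithinAt t ht),
          (WithLp.sndL 2 ℂ H H).continuous.comp_continuousOn (hu T).cont⟩, ?_, ?_, fun t ht φ => ?_⟩
      · refine h.root_injective ?_
        simp only [h.root_lift, hu0, inverseGenerator_fst, WithLp.toLp_fst, WithLp.toLp_snd]
        refine ext_inner_left ℂ fun f => ?_
        have := hg (h.lift f)
        rw [← h.inner_damp, form, h.root_lift, h.incl_lift, h.symm] at this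
        rw [map_neg, inner_sub_right, inner_neg_right, inner_neg_right, ← this]
        ring
      · simp only [hu0, WithLp.toLp_fst, h.lift_root]
      · rw [← h.inner_damp, form, h.root_lift, h.root_lift, ← h.inner_root_apply,
          inverseGenerator_fst, inner_sub_right, inner_neg_right]
        ring
    exact ⟨_, _, _, fun T hT => ⟨hstrong T, fun W' V' Z' w' =>
      h.eqOn_of_isWeakWave hT (h.isWeakWave_of_isStrongWave (hstrong T))
        (h.isWeakWave_of_isStrongWave w')⟩⟩
  · intro W₀ W₁
    obtain ⟨u, hu0, -, -, hu⟩ := hd.exists_isMild hr (WithLp.toLp 2 (HalfSpace.root A W₀, W₁))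
    have hweak : ∀ T, IsWeakWave A 𝓑 T W₀ W₁ (fun t => h.lift (u t).fst) (fun t => (u t).snd) := by
      intro T
      rw [h.isWeakWave_iff]
      simp only [h.root_lift, hu0, WithLp.toLp_fst, WithLp.toLp_snd, h.lift_root, and_true]
      exact hu T
    exact ⟨_, _, fun T hT => ⟨hweak T,
      (hu T).inH1 (re_inner_inverseGenerator h.symm (h.re_inner_damp 𝓑)) hr hT,
      fun W' V' w' => h.eqOn_of_isWeakWave hT (hweak T) w'⟩⟩
  · intro T hT
    -- Each of the two components is bounded by the energy norm, which does not exceed its initial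
    -- value.
    refine ⟨2, fun W₀ W₁ W V w t ht => ?_⟩
    have h1 := hd.norm_le_of_isMild hr hT ((h.isWeakWave_iff 𝓑).1 w).1 t ht
    have h2 := WithLp.norm_fst_le H (WithLp.toLp 2 (HalfSpace.root A (W t), V t))
    have h3 := WithLp.norm_snd_le H (WithLp.toLp 2 (HalfSpace.root A (W t), V t))
    have h4 := norm_toLp_le (HalfSpace.root A W₀) W₁
    rw [w.init₀, w.init₁] at h1
    simp only [HalfSpace.norm_def]
    simp only [WithLp.toLp_fst, WithLp.toLp_snd] at h2 h3
    linarith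

end IsRootInverse

end Wave

/-- Polar decomposition. From `P² = K K*` follows `‖K* z‖ = ‖P z‖`, so `P z ↦ K* z` extends
isometrically from the dense range of `P`; the image `w` of `y` satisfies `K w = P y` by continuity.
-/
theorem exists_preimage_of_sq_eq {X : Type*} [NormedAddCommGroup X] [InnerProductSpace ℂ X]
    [CompleteSpace X] {P K K' : X →L[ℂ] X} (hP : ∀ x y, ⟪P x, y⟫_ℂ = ⟪x, P y⟫_ℂ)
    (hK : ∀ x y, ⟪K x, y⟫_ℂ = ⟪x, K' y⟫_ℂ) (hPK : ∀ x, P (P x) = K (K' x)) (hd : DenseRange P)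
    (y : X) : ∃ w, K w = P y ∧ ‖w‖ = ‖y‖ := by
  have hn : ∀ z, ‖K' z‖ = ‖P z‖ := by
    intro z
    have : ⟪K' z, K' z⟫_ℂ = ⟪P z, P z⟫_ℂ := by rw [← hK, ← hPK, hP]
    rw [inner_self_eq_norm_sq_to_K, inner_self_eq_norm_sq_to_K] at this
    exact (sq_eq_sq₀ (norm_nonneg _) (norm_nonneg _)).1 (by exact_mod_cast this)
  obtain ⟨s, hs, hsy⟩ := mem_closure_iff_seq_limit.1 (hd y)
  choose z hz using hs
  have hcau : CauchySeq fun n => K' (z n) := by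
    rw [Metric.cauchySeq_iff]
    intro ε hε
    obtain ⟨N, hN⟩ := Metric.cauchySeq_iff.1 hsy.cauchySeq ε hε
    refine ⟨N, fun m hm n hn' => ?_⟩
    rw [dist_eq_norm, ← map_sub, hn, map_sub, hz, hz, ← dist_eq_norm]
    exact hN m hm n hn'
  obtain ⟨w, hw⟩ := cauchySeq_tendsto_of_complete hcau
  refine ⟨w, ?_, ?_⟩
  · refine tendsto_nhds_unique ((K.continuous.tendsto w).comp hw) ?_
    refine ((P.continuous.tendsto y).comp hsy).congr fun n => ?_
    simp only [Function.comp_apply]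
    rw [← hz, hPK]
  · refine tendsto_nhds_unique hw.norm (hsy.norm.congr fun n => ?_)
    rw [hn, hz]

/-! ### Bounded restrictions to `H_{1/2}` -/

section Restrict

variable {H K : Type*} [NormedAddCommGroup H] [InnerProductSpace ℂ H] [CompleteSpace H]
  [NormedAddCommGroup K] [InnerProductSpace ℂ K] {A : H →ₗ.[ℂ] H} {C : H →ₗ.[ℂ] K}

/-- The restriction of `C` to `H_{1/2}` as a bounded operator. -/
def restrictHalfL (h : EmbedsInDomain A C) : HalfSpace A →L[ℂ] K :=
  LinearMap.mkContinuous (restrictHalf h) h.choose fun x => by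
    obtain ⟨hx, hle⟩ := h.choose_spec x
    rw [restrictHalf_apply h x hx]
    linarith [norm_nonneg (x : H)]

theorem restrictHalfL_apply (h : EmbedsInDomain A C) (x : HalfSpace A) :
    restrictHalfL h x = restrictHalf h x := rfl

theorem mem_graph_restrictHalf (h : EmbedsInDomain A C) (x : HalfSpace A) :
    ((x : H), restrictHalf h x) ∈ C.graph := LinearPMap.mem_graph C ⟨x, (h.choose_spec x).choose⟩

theorem EmbedsInDomain.exists_norm_incl_le (h : EmbedsInDomain A C) :
    ∃ c : ℝ, ∀ x : HalfSpace A, ‖(x : H)‖ ≤ c * ‖x‖ := by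
  obtain ⟨c, hc⟩ := h
  refine ⟨c, fun x => ?_⟩
  obtain ⟨hx, hle⟩ := hc x
  linarith [norm_nonneg (C ⟨(x : H), hx⟩)]

end Restrict

/-! ### The block operator and its square root -/

section Block

variable {H₁ H₂ : Type*}
  [NormedAddCommGroup H₁] [InnerProductSpace ℂ H₁] [CompleteSpace H₁]
  [NormedAddCommGroup H₂] [InnerProductSpace ℂ H₂] [CompleteSpace H₂]
  {A₁ : H₁ →ₗ.[ℂ] H₁} {A₂ : H₂ →ₗ.[ℂ] H₂} {R₁ : H₁ →L[ℂ] H₁} {R₂ : H₂ →L[ℂ] H₂}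
  {C : H₂ →ₗ.[ℂ] H₁}

theorem inner_restrictHalf_adjoint (h₂ : IsRootInverse A₂ R₂) (hCs : EmbedsInDomain A₁ C.adjoint)
    (hC : EmbedsInDomain A₂ C) (φ : HalfSpace A₁) (ψ : HalfSpace A₂) :
    ⟪restrictHalf hCs φ, (ψ : H₂)⟫_ℂ = ⟪(φ : H₁), restrictHalf hC ψ⟫_ℂ := by
  -- The adjoint relation needs `C` densely defined; its domain contains the dense range of
  -- `A₂^{-1/2}`.
  have hd : Dense (C.domain : Set H₂) := h₂.dense_range.mono (by
    rintro _ ⟨y, rfl⟩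
    exact (hC.choose_spec (h₂.lift y)).choose)
  exact LinearPMap.adjoint_isFormalAdjoint hd ⟨φ, (hCs.choose_spec φ).choose⟩
    ⟨ψ, (hC.choose_spec ψ).choose⟩

/-- The inverse `(f, g) ↦ (A₁^{-1/2} f, A₂^{-1/2} (g - C* A₁^{-1/2} f))` of the operator
`(u, v) ↦ (A₁^{1/2} u, C* u + A₂^{1/2} v)`. -/
def blockRoot (h₁ : IsRootInverse A₁ R₁) (R₂ : H₂ →L[ℂ] H₂)
    (hCs : EmbedsInDomain A₁ C.adjoint) : WithLp 2 (H₁ × H₂) →L[ℂ] WithLp 2 (H₁ × H₂) :=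
  pairL (R₁.comp (WithLp.fstL 2 ℂ H₁ H₂)) (R₂.comp (WithLp.sndL 2 ℂ H₁ H₂ -
    ((restrictHalfL hCs).comp h₁.lift).comp (WithLp.fstL 2 ℂ H₁ H₂)))

/-- The adjoint of `blockRoot`. -/
def blockRootAdj (R₁ : H₁ →L[ℂ] H₁) (h₂ : IsRootInverse A₂ R₂)
    (hC : EmbedsInDomain A₂ C) : WithLp 2 (H₁ × H₂) →L[ℂ] WithLp 2 (H₁ × H₂) :=
  pairL (R₁.comp (WithLp.fstL 2 ℂ H₁ H₂ -
    ((restrictHalfL hC).comp h₂.lift).comp (WithLp.sndL 2 ℂ H₁ H₂)))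
    (R₂.comp (WithLp.sndL 2 ℂ H₁ H₂))

variable (h₁ : IsRootInverse A₁ R₁) (h₂ : IsRootInverse A₂ R₂)
  (hCs : EmbedsInDomain A₁ C.adjoint) (hC : EmbedsInDomain A₂ C)

theorem blockRoot_fst (x : WithLp 2 (H₁ × H₂)) : (blockRoot h₁ R₂ hCs x).fst = R₁ x.fst := rfl

theorem blockRoot_snd (x : WithLp 2 (H₁ × H₂)) :
    (blockRoot h₁ R₂ hCs x).snd = R₂ (x.snd - restrictHalf hCs (h₁.lift x.fst)) := rfl

omit [CompleteSpace H₁] in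
theorem blockRootAdj_fst (x : WithLp 2 (H₁ × H₂)) :
    (blockRootAdj R₁ h₂ hC x).fst = R₁ (x.fst - restrictHalf hC (h₂.lift x.snd)) := rfl

omit [CompleteSpace H₁] in
theorem blockRootAdj_snd (x : WithLp 2 (H₁ × H₂)) :
    (blockRootAdj R₁ h₂ hC x).snd = R₂ x.snd := rfl

include h₁ h₂ in
-- This duality between `C` and `C*` is the source both of the adjoint of `blockRoot` and of the
-- skewness of the coupling.
theorem inner_restrictHalf_lift (f : H₁) (q : H₂) :
    ⟪R₂ (restrictHalf hCs (h₁.lift f)), q⟫_ℂ = ⟪f, R₁ (restrictHalf hC (h₂.lift q))⟫_ℂ := by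
  rw [h₂.symm, ← h₁.symm, ← h₂.incl_lift, inner_restrictHalf_adjoint h₂ hCs hC, h₁.incl_lift]

theorem inner_blockRoot (x y : WithLp 2 (H₁ × H₂)) :
    ⟪blockRoot h₁ R₂ hCs x, y⟫_ℂ = ⟪x, blockRootAdj R₁ h₂ hC y⟫_ℂ := by
  rw [inner_prodL2, inner_prodL2, blockRoot_fst, blockRoot_snd, blockRootAdj_fst,
    blockRootAdj_snd, map_sub, map_sub, inner_sub_left, inner_sub_right,
    inner_restrictHalf_lift h₁ h₂ hCs hC, h₁.symm, h₂.symm]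
  ring

theorem blockRootAdj_injective {x : WithLp 2 (H₁ × H₂)} (h₁ : IsRootInverse A₁ R₁)
    (hx : blockRootAdj R₁ h₂ hC x = 0) : x = 0 := by
  have e2 : x.snd = 0 := h₂.injective (congrArg (fun z : WithLp 2 (H₁ × H₂) => z.snd) hx)
  have e1 : x.fst = 0 := by
    have : R₁ (x.fst - restrictHalf hC (h₂.lift x.snd)) = 0 :=
      congrArg (fun z : WithLp 2 (H₁ × H₂) => z.fst) hx
    simpa [e2] using h₁.injective this
  exact (WithLp.equiv 2 (H₁ × H₂)).injective (Prod.ext e1 e2)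

/-- The block equation is triangular: the second line gives `C* u + A₂^{1/2} v = R₂ y.snd`, the
first then gives `u`, and subtracting `C* u` gives `v`. -/
theorem mem_graph_blockOp_iff (s₁ : IsSquareRoot (sqrtOp A₁) A₁) (x y : WithLp 2 (H₁ × H₂)) :
    (x, y) ∈ (blockOp A₁ A₂ C).graph ↔
      x = blockRoot h₁ R₂ hCs (blockRootAdj R₁ h₂ hC y) := by
  rw [graph_blockOp]
  constructor
  · rintro ⟨a, b, u, v, e1, e2, e3, e4, e5, e6⟩
    simp only at e1 e2 e3 e4 e5 e6
    rw [h₁.mem_graph_sq s₁] at e1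
    rw [h₂.mem_graph] at e3 e5
    have hu : u = restrictHalf hCs (h₁.lift (R₁ a)) :=
      C.adjoint.mem_graph_snd_inj e2 (mem_graph_restrictHalf hCs (h₁.lift (R₁ a))) e1
    have hb : b = restrictHalf hC (h₂.lift y.snd) :=
      C.mem_graph_snd_inj e4 (mem_graph_restrictHalf hC (h₂.lift y.snd)) e5
    have ha : y.fst - restrictHalf hC (h₂.lift y.snd) = a := by rw [e6, ← hb, add_sub_cancel_right]
    refine (WithLp.equiv 2 (H₁ × H₂)).injective (Prod.ext ?_ ?_)
    · change x.fst = R₁ (R₁ (y.fst - restrictHalf hC (h₂.lift y.snd)))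
      rw [ha, e1]
    · change x.snd = R₂ (R₂ y.snd - restrictHalf hCs (h₁.lift
        (R₁ (y.fst - restrictHalf hC (h₂.lift y.snd)))))
      rw [ha, ← hu, ← e5, add_sub_cancel_left, e3]
  · rintro rfl
    refine ⟨y.fst - restrictHalf hC (h₂.lift y.snd), restrictHalf hC (h₂.lift y.snd),
      restrictHalf hCs (h₁.lift (R₁ (y.fst - restrictHalf hC (h₂.lift y.snd)))),
      R₂ y.snd - restrictHalf hCs (h₁.lift (R₁ (y.fst - restrictHalf hC (h₂.lift y.snd)))),
      ?_, ?_, ?_, ?_, ?_, ?_⟩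
    · rw [h₁.mem_graph_sq s₁]
      rfl
    · exact mem_graph_restrictHalf hCs
        (h₁.lift (R₁ (y.fst - restrictHalf hC (h₂.lift y.snd))))
    · rw [h₂.mem_graph]
      rfl
    · rw [add_sub_cancel]
      exact mem_graph_restrictHalf hC (h₂.lift y.snd)
    · rw [add_sub_cancel, h₂.mem_graph]
    · simp

include h₁ h₂ hCs hC in
/-- The block operator is positive and self-adjoint, and its square root has a bounded inverse,
which has the same range as `blockRoot`. -/
theorem blockOp_isPositiveSelfAdjoint (s₁ : IsSquareRoot (sqrtOp A₁) A₁) :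
    IsPositiveSelfAdjoint (blockOp A₁ A₂ C) ∧ ∃ R, IsRootInverse (blockOp A₁ A₂ C) R ∧
      ∀ y, ∃ w, blockRoot h₁ R₂ hCs w = R y ∧ ‖w‖ = ‖y‖ := by
  let G : WithLp 2 (H₁ × H₂) →L[ℂ] WithLp 2 (H₁ × H₂) :=
    (blockRoot h₁ R₂ hCs).comp (blockRootAdj R₁ h₂ hC)
  have hGg := mem_graph_blockOp_iff h₁ h₂ hCs hC s₁
  have hadj : blockRootAdj R₁ h₂ hC = ContinuousLinearMap.adjoint (blockRoot h₁ R₂ hCs) := by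
    rw [ContinuousLinearMap.eq_adjoint_iff]
    intro x y
    rw [← inner_conj_symm, ← inner_blockRoot h₁ h₂ hCs hC, inner_conj_symm]
  -- `G` is `K K*` with `K` the block root.
  have hGpos : G.IsPositive := by
    have := (ContinuousLinearMap.isPositive_id (𝕜 := ℂ) (E := WithLp 2 (H₁ × H₂))).conj_adjoint
      (blockRoot h₁ R₂ hCs)
    rw [← hadj] at this
    exact this
  have hGin : ∀ y, ⟪y, G y⟫_ℂ = (‖blockRootAdj R₁ h₂ hC y‖ ^ 2 : ℝ) := by
    intro y
    rw [show ⟪y, G y⟫_ℂ = ⟪G y, y⟫_ℂ from (hGpos.isSymmetric y y).symm]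
    change ⟪blockRoot h₁ R₂ hCs (blockRootAdj R₁ h₂ hC y), y⟫_ℂ = _
    rw [inner_blockRoot h₁ h₂ hCs hC, inner_self_eq_norm_sq_to_K]
    norm_cast
  have hGinj : ∀ y, G y = 0 → y = 0 := by
    intro y hy
    have := hGin y
    rw [hy, inner_zero_right] at this
    refine blockRootAdj_injective h₂ hC h₁ ?_
    have h0 : ‖blockRootAdj R₁ h₂ hC y‖ ^ 2 = 0 := by exact_mod_cast this.symm
    simpa using h0
  have hsa := isSelfAdjoint_of_graph_eq_inverse (fun x y => hGpos.isSymmetric x y) hGinj hGg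
  have hroot := sqrtOp_isSquareRoot (exists_isSquareRoot hGpos hGinj hGg)
  refine ⟨⟨hsa.1, hsa.2, fun x hx => ?_⟩, ?_⟩
  · have e : (x : WithLp 2 (H₁ × H₂)) = G (blockOp A₁ A₂ C x) :=
      (hGg _ _).1 (LinearPMap.mem_graph _ x)
    have hne : blockOp A₁ A₂ C x ≠ 0 := fun h => hx (by rw [e, h, map_zero])
    have hn : blockRootAdj R₁ h₂ hC (blockOp A₁ A₂ C x) ≠ 0 := fun h =>
      hne (blockRootAdj_injective h₂ hC h₁ h)
    conv_rhs => rw [e]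
    rw [hGin, Complex.ofReal_re]
    positivity
  · obtain ⟨R, hR⟩ := exists_isRootInverse_of_bijective hroot.selfAdjoint
      (fun x hx => by
        have := (hGg x 0).1 ((hroot.sq _ _).2 ⟨0, hx, zero_mem _⟩)
        simpa using this)
      -- Factoring `(G y, y)` through the square root exhibits `y` as a value of `A^{1/2}`.
      (fun y => by
        obtain ⟨z, -, hz⟩ := (hroot.sq (G y) y).1 ((hGg _ _).2 rfl)
        exact ⟨z, hz⟩)
    exact ⟨R, hR, exists_preimage_of_sq_eq hR.symm (inner_blockRoot h₁ h₂ hCs hC)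
      (fun y => ((hR.mem_graph_sq hroot _ _).1 ((hGg _ y).2 rfl)).symm) hR.dense_range⟩

/-- Every `Φ` in `D(A^{1/2})` is `K w` with `‖w‖ = ‖Φ‖`, and the first component of `K w` is
`A₁^{-1/2} w.fst`. The projection to `H_{1,1/2}` is therefore a contraction `π`, and `𝓑₀ u` is `B u`
composed with `π`. -/
theorem exists_isColumn {U : Type*} [NormedAddCommGroup U] [InnerProductSpace ℂ U]
    {A : WithLp 2 (H₁ × H₂) →ₗ.[ℂ] WithLp 2 (H₁ × H₂)}
    {R : WithLp 2 (H₁ × H₂) →L[ℂ] WithLp 2 (H₁ × H₂)} (hR : IsRootInverse A R)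
    (hw : ∀ y, ∃ w, blockRoot h₁ R₂ hCs w = R y ∧ ‖w‖ = ‖y‖) (B : U →L[ℂ] HalfDual A₁) :
    ∃ 𝓑₀ : U →L[ℂ] HalfDual A, IsColumn B 𝓑₀ := by
  have key : ∀ Φ : HalfSpace A, ∃ f : H₁, (Φ : WithLp 2 (H₁ × H₂)).fst = R₁ f ∧ ‖f‖ ≤ ‖Φ‖ := by
    intro Φ
    obtain ⟨w, hw1, hw2⟩ := hw (HalfSpace.root A Φ)
    refine ⟨w.fst, ?_, ?_⟩
    · rw [← hR.apply_root Φ, ← hw1, blockRoot_fst]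
    · rw [HalfSpace.norm_def, ← hw2]
      exact WithLp.norm_fst_le _ w
  have hmem : ∀ Φ : HalfSpace A, (Φ : WithLp 2 (H₁ × H₂)).fst ∈ (sqrtOp A₁).domain := by
    intro Φ
    obtain ⟨f, hf, -⟩ := key Φ
    rw [hf]
    exact h₁.mem_domain f
  let π : HalfSpace A →L[ℂ] HalfSpace A₁ := LinearMap.mkContinuous
    { toFun := fun Φ => HalfSpace.mk (Φ : WithLp 2 (H₁ × H₂)).fst (hmem Φ)
      map_add' := fun _ _ => rfl
      map_smul' := fun _ _ => rfl } 1 fun Φ => by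
    obtain ⟨f, hf, hle⟩ := key Φ
    have : HalfSpace.mk (Φ : WithLp 2 (H₁ × H₂)).fst (hmem Φ) = h₁.lift f := Subtype.ext hf
    change ‖HalfSpace.mk (Φ : WithLp 2 (H₁ × H₂)).fst (hmem Φ)‖ ≤ _
    rw [this, h₁.norm_lift, one_mul]
    exact hle
  exact ⟨(B.flip.comp π).flip, fun Φ => ⟨hmem Φ, fun u => rfl⟩⟩

end Block

/-! ### The coupled system as a mild equation -/

section CoupledGenerator

variable {H₁ H₂ U : Type*}
  [NormedAddCommGroup H₁] [InnerProductSpace ℂ H₁] [CompleteSpace H₁]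
  [NormedAddCommGroup H₂] [InnerProductSpace ℂ H₂] [CompleteSpace H₂]
  [NormedAddCommGroup U] [InnerProductSpace ℂ U] [CompleteSpace U]
  {A₁ : H₁ →ₗ.[ℂ] H₁} {A₂ : H₂ →ₗ.[ℂ] H₂} {R₁ : H₁ →L[ℂ] H₁} {R₂ : H₂ →L[ℂ] H₂}
  {C : H₂ →ₗ.[ℂ] H₁}

/-- The operator `A₁^{-1/2} ⊕ A₂^{-1/2}`. -/
def diagRoot (R₁ : H₁ →L[ℂ] H₁) (R₂ : H₂ →L[ℂ] H₂) :
    WithLp 2 (H₁ × H₂) →L[ℂ] WithLp 2 (H₁ × H₂) :=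
  pairL (R₁.comp (WithLp.fstL 2 ℂ H₁ H₂)) (R₂.comp (WithLp.sndL 2 ℂ H₁ H₂))

/-- The sum of the damping and the skew-adjoint coupling of the two equations. -/
def coupling (h₁ : IsRootInverse A₁ R₁) (h₂ : IsRootInverse A₂ R₂) (B : U →L[ℂ] HalfDual A₁)
    (hCs : EmbedsInDomain A₁ C.adjoint) (hC : EmbedsInDomain A₂ C) :
    WithLp 2 (H₁ × H₂) →L[ℂ] WithLp 2 (H₁ × H₂) :=
  pairL ((h₁.damp B).comp (WithLp.fstL 2 ℂ H₁ H₂) +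
      (R₁.comp ((restrictHalfL hC).comp h₂.lift)).comp (WithLp.sndL 2 ℂ H₁ H₂))
    (-((R₂.comp ((restrictHalfL hCs).comp h₁.lift)).comp (WithLp.fstL 2 ℂ H₁ H₂)))

omit [CompleteSpace H₁] [CompleteSpace H₂] in
theorem diagRoot_fst (x : WithLp 2 (H₁ × H₂)) : (diagRoot R₁ R₂ x).fst = R₁ x.fst := rfl

omit [CompleteSpace H₁] [CompleteSpace H₂] in
theorem diagRoot_snd (x : WithLp 2 (H₁ × H₂)) : (diagRoot R₁ R₂ x).snd = R₂ x.snd := rfl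

variable (h₁ : IsRootInverse A₁ R₁) (h₂ : IsRootInverse A₂ R₂) (B : U →L[ℂ] HalfDual A₁)
  (hCs : EmbedsInDomain A₁ C.adjoint) (hC : EmbedsInDomain A₂ C)

theorem coupling_fst (x : WithLp 2 (H₁ × H₂)) : (coupling h₁ h₂ B hCs hC x).fst =
    h₁.damp B x.fst + R₁ (restrictHalf hC (h₂.lift x.snd)) := rfl

theorem coupling_snd (x : WithLp 2 (H₁ × H₂)) : (coupling h₁ h₂ B hCs hC x).snd =
    -R₂ (restrictHalf hCs (h₁.lift x.fst)) := rfl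

include h₁ h₂ in
theorem diagRoot_symm (x y : WithLp 2 (H₁ × H₂)) :
    ⟪diagRoot R₁ R₂ x, y⟫_ℂ = ⟪x, diagRoot R₁ R₂ y⟫_ℂ := by
  rw [inner_prodL2, inner_prodL2, diagRoot_fst, diagRoot_snd, diagRoot_fst, diagRoot_snd,
    h₁.symm, h₂.symm]

include h₁ h₂ in
theorem diagRoot_injective (x : WithLp 2 (H₁ × H₂)) (hx : diagRoot R₁ R₂ x = 0) : x = 0 :=
  (WithLp.equiv 2 (H₁ × H₂)).injective (Prod.ext
    (h₁.injective (congrArg (fun z : WithLp 2 (H₁ × H₂) => z.fst) hx))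
    (h₂.injective (congrArg (fun z : WithLp 2 (H₁ × H₂) => z.snd) hx)))

/-- The off-diagonal blocks are adjoint up to sign, so they contribute nothing to the real part. -/
theorem re_inner_coupling (x : WithLp 2 (H₁ × H₂)) :
    (⟪coupling h₁ h₂ B hCs hC x, x⟫_ℂ).re =
      ‖((h₁.obs B).comp (WithLp.fstL 2 ℂ H₁ H₂)) x‖ ^ 2 := by
  rw [inner_prodL2, coupling_fst, coupling_snd, inner_add_left, inner_neg_left,
    inner_restrictHalf_lift h₁ h₂ hCs hC, ← inner_conj_symm x.fst]
  simp only [Complex.add_re, Complex.neg_re, Complex.conj_re, h₁.re_inner_damp]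
  change _ = ‖h₁.obs B x.fst‖ ^ 2
  ring

/-- The state `(A₁^{1/2} w₁, A₂^{1/2} w₂, v₁, v₂)` of the coupled system. -/
def coupledState (w₁ : HalfSpace A₁) (w₂ : HalfSpace A₂) (v₁ : H₁) (v₂ : H₂) :
    WithLp 2 (WithLp 2 (H₁ × H₂) × WithLp 2 (H₁ × H₂)) :=
  WithLp.toLp 2 (WithLp.toLp 2 (HalfSpace.root A₁ w₁, HalfSpace.root A₂ w₂),
    WithLp.toLp 2 (v₁, v₂))

/-- The inverse of the generator of the coupled system. -/
def coupledInverse : WithLp 2 (WithLp 2 (H₁ × H₂) × WithLp 2 (H₁ × H₂)) →L[ℂ]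
    WithLp 2 (WithLp 2 (H₁ × H₂) × WithLp 2 (H₁ × H₂)) :=
  inverseGenerator (diagRoot R₁ R₂) (coupling h₁ h₂ B hCs hC)

theorem re_inner_coupledInverse (x : WithLp 2 (WithLp 2 (H₁ × H₂) × WithLp 2 (H₁ × H₂))) :
    (⟪coupledInverse h₁ h₂ B hCs hC x, x⟫_ℂ).re =
      -‖(((h₁.obs B).comp (WithLp.fstL 2 ℂ H₁ H₂)).comp
        (WithLp.fstL 2 ℂ (WithLp 2 (H₁ × H₂)) (WithLp 2 (H₁ × H₂)))) x‖ ^ 2 :=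
  re_inner_inverseGenerator (diagRoot_symm h₁ h₂) (re_inner_coupling h₁ h₂ B hCs hC) x

theorem dissipative_coupledInverse : Dissipative (coupledInverse h₁ h₂ B hCs hC) := fun x => by
  rw [re_inner_coupledInverse]
  simp

theorem denseRange_coupledInverse : DenseRange (coupledInverse h₁ h₂ B hCs hC) :=
  denseRange_inverseGenerator (diagRoot_symm h₁ h₂) (diagRoot_injective h₁ h₂)

/-- Adding the two weak equations, tested with `A₁^{-1/2} f.fst` and `A₂^{-1/2} f.snd`, gives the
mild equation; test vectors with one zero component separate them again. -/
theorem isWeakCoupled_iff {T : ℝ} {p₁ : HalfSpace A₁} {p₂ : HalfSpace A₂} {q₁ : H₁} {q₂ : H₂}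
    {w₁ : ℝ → HalfSpace A₁} {w₂ : ℝ → HalfSpace A₂} {v₁ : ℝ → H₁} {v₂ : ℝ → H₂} :
    IsWeakCoupled B (restrictHalf hC) (restrictHalf hCs) T p₁ p₂ q₁ q₂ w₁ w₂ v₁ v₂ ↔
      IsMild (coupledInverse h₁ h₂ B hCs hC) T
        (fun t => coupledState (w₁ t) (w₂ t) (v₁ t) (v₂ t)) ∧
      (w₁ 0 = p₁ ∧ v₁ 0 = q₁) ∧ (w₂ 0 = p₂ ∧ v₂ 0 = q₂) := by
  unfold coupledState coupledInverse
  constructor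
  · intro w
    refine ⟨isMild_inverseGenerator_iff.2 ⟨continuousOn_toLp
      ((rootL A₁).continuous.comp_continuousOn w.c0₁)
      ((rootL A₂).continuous.comp_continuousOn w.c0₂),
      continuousOn_toLp w.c1₁.cont w.c1₂.cont, fun f t ht => ?_, fun f t ht => ?_⟩,
      w.init₁, w.init₂⟩
    · have e1 := w.eqn₁ t ht (h₁.lift f.fst)
      have e2 := w.eqn₂ t ht (h₂.lift f.snd)
      rw [form, h₁.root_lift] at e1
      rw [form, h₂.root_lift] at e2
      have e := e1.add e2
      rw [← neg_add] at e
      rw [inner_prodL2]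
      refine e.congr_of_mem (fun s _ => ?_) ht
      rw [inner_add_right, inner_prodL2, inner_prodL2, coupling_fst, coupling_snd, diagRoot_fst,
        diagRoot_snd]
      simp only [Pi.add_apply, WithLp.toLp_fst, WithLp.toLp_snd, h₁.lift_root, h₂.lift_root,
        inner_add_right, inner_neg_right, ← h₁.inner_damp, h₁.root_lift, h₁.incl_lift,
        h₂.incl_lift, h₁.symm, h₂.symm]
      ring
    · have e1 := hasDerivWithinAt_inner_const (w.c1₁.deriv t ht) f.fst
      have e2 := hasDerivWithinAt_inner_const (w.c1₂.deriv t ht) f.snd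
      rw [inner_prodL2]
      refine (e1.add e2).congr_of_mem (fun s _ => ?_) ht
      rw [inner_prodL2, diagRoot_fst, diagRoot_snd]
      simp only [Pi.add_apply, WithLp.toLp_fst, WithLp.toLp_snd, h₁.apply_root, h₂.apply_root]
  · rintro ⟨hm, h3, h4⟩
    obtain ⟨ha, hb, e1, -⟩ := isMild_inverseGenerator_iff.1 hm
    have ha₁ := (WithLp.fstL 2 ℂ H₁ H₂).continuous.comp_continuousOn ha
    have ha₂ := (WithLp.sndL 2 ℂ H₁ H₂).continuous.comp_continuousOn ha
    refine ⟨?_, ?_, ⟨fun t ht => ?_, (WithLp.fstL 2 ℂ H₁ H₂).continuous.comp_continuousOn hb⟩,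
      ⟨fun t ht => ?_, (WithLp.sndL 2 ℂ H₁ H₂).continuous.comp_continuousOn hb⟩, h3, h4,
      fun t ht φ => ?_, fun t ht ψ => ?_⟩
    · simpa only [Function.comp_def, WithLp.fstL_apply, WithLp.toLp_fst, h₁.lift_root] using
        h₁.lift.continuous.comp_continuousOn ha₁
    · simpa only [Function.comp_def, WithLp.sndL_apply, WithLp.toLp_snd, h₂.lift_root] using
        h₂.lift.continuous.comp_continuousOn ha₂
    · have := hasDerivWithinAt_clm ((WithLp.fstL 2 ℂ H₁ H₂).comp (WithLp.sndL 2 ℂ _ _))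
        (hm.hasDerivWithinAt t ht)
      simpa only [ContinuousLinearMap.comp_apply, WithLp.sndL_apply, WithLp.fstL_apply,
        inverseGenerator_snd, diagRoot_fst, WithLp.toLp_fst, WithLp.toLp_snd, h₁.apply_root]
        using this
    · have := hasDerivWithinAt_clm ((WithLp.sndL 2 ℂ H₁ H₂).comp (WithLp.sndL 2 ℂ _ _))
        (hm.hasDerivWithinAt t ht)
      simpa only [ContinuousLinearMap.comp_apply, WithLp.sndL_apply, WithLp.fstL_apply,
        inverseGenerator_snd, diagRoot_snd, WithLp.toLp_fst, WithLp.toLp_snd, h₂.apply_root]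
        using this
    · have e := e1 (WithLp.toLp 2 (HalfSpace.root A₁ φ, 0)) t ht
      simp only [inner_prodL2, inner_add_right, coupling_fst, diagRoot_fst,
        WithLp.toLp_fst, WithLp.toLp_snd, inner_zero_left, add_zero, h₁.inner_damp,
        h₁.inner_root_apply, h₂.lift_root] at e
      refine e.congr_of_mem (fun s _ => ?_) ht
      ring
    · have e := e1 (WithLp.toLp 2 (0, HalfSpace.root A₂ ψ)) t ht
      simp only [inner_prodL2, inner_add_right, coupling_snd, diagRoot_snd,
        WithLp.toLp_fst, WithLp.toLp_snd, inner_zero_left, zero_add, inner_neg_right,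
        h₂.inner_root_apply, h₁.lift_root] at e
      refine e.congr_of_mem (fun s _ => ?_) ht
      ring

include h₁ h₂ in
theorem isWeakCoupled_of_isStrongCoupled (s₂ : IsSquareRoot (sqrtOp A₂) A₂) {T : ℝ}
    {p₁ : HalfSpace A₁} {p₂ : HalfSpace A₂} {q₁ : HalfSpace A₁} {q₂ : HalfSpace A₂}
    {w₁ : ℝ → HalfSpace A₁} {w₂ : ℝ → HalfSpace A₂} {v₁ : ℝ → HalfSpace A₁}
    {v₂ : ℝ → HalfSpace A₂} {z₁ : ℝ → H₁} {z₂ : ℝ → H₂}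
    (w : IsStrongCoupled B (restrictHalf hC) (restrictHalf hCs) T p₁ p₂ q₁ q₂ w₁ w₂ v₁ v₂ z₁ z₂) :
    IsWeakCoupled B (restrictHalf hC) (restrictHalf hCs) T p₁ p₂ (q₁ : H₁) (q₂ : H₂) w₁ w₂
      (fun t => (v₁ t : H₁)) (fun t => (v₂ t : H₂)) := by
  have hc₁ : ContinuousOn (fun t => h₁.lift (HalfSpace.root A₁ (w₁ t))) (Icc 0 T) :=
    h₁.lift.continuous.comp_continuousOn fun t ht =>
      (hasDerivWithinAt_clm (rootL A₁) (w.c1₁.deriv t ht)).continuousWithinAt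
  have hc₂ : ContinuousOn (fun t => h₂.lift (HalfSpace.root A₂ (w₂ t))) (Icc 0 T) :=
    h₂.lift.continuous.comp_continuousOn fun t ht =>
      (hasDerivWithinAt_clm (rootL A₂) (w.c1₂.deriv t ht)).continuousWithinAt
  simp only [h₁.lift_root] at hc₁
  simp only [h₂.lift_root] at hc₂
  refine ⟨hc₁, hc₂, ⟨fun t ht => ?_, fun t ht => (w.c2₁.deriv t ht).continuousWithinAt⟩,
    ⟨fun t ht => ?_, fun t ht => (w.c2₂.deriv t ht).continuousWithinAt⟩,
    ⟨w.init₁.1, by rw [w.init₁.2]⟩, ⟨w.init₂.1, by rw [w.init₂.2]⟩, fun t ht φ => ?_,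
    fun t ht ψ => ?_⟩
  · have := hasDerivWithinAt_clm (R₁.comp (rootL A₁)) (w.c1₁.deriv t ht)
    simpa only [ContinuousLinearMap.comp_apply, rootL_apply, h₁.apply_root] using this
  · have := hasDerivWithinAt_clm (R₂.comp (rootL A₂)) (w.c1₂.deriv t ht)
    simpa only [ContinuousLinearMap.comp_apply, rootL_apply, h₂.apply_root] using this
  · have e1 := hasDerivWithinAt_inner_const (w.c2₁.deriv t ht) (φ : H₁)
    have e2 := hasDerivWithinAt_inner_const (hasDerivWithinAt_clm ((h₁.damp B).comp (rootL A₁))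
      (w.c1₁.deriv t ht)) (HalfSpace.root A₁ φ)
    have e3 := hasDerivWithinAt_inner_const (hasDerivWithinAt_clm (restrictHalfL hC)
      (w.c1₂.deriv t ht)) (φ : H₁)
    simp only [ContinuousLinearMap.comp_apply, rootL_apply, h₁.inner_damp] at e2
    refine ((e1.add e2).add e3).congr_deriv ?_
    rw [restrictHalfL_apply]
    linear_combination w.eqn₁ t ht φ
  · have e1 := hasDerivWithinAt_inner_const (w.c2₂.deriv t ht) (ψ : H₂)
    have e2 := hasDerivWithinAt_inner_const (hasDerivWithinAt_clm (restrictHalfL hCs)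
      (w.c1₁.deriv t ht)) (ψ : H₂)
    refine (e1.sub e2).congr_deriv ?_
    obtain ⟨hd, heq⟩ := w.eqn₂ t ht
    -- Because `w₂ t` lies in `D(A₂)`, the form `form A₂ ψ (w₂ t)` is `⟨ψ, A₂ w₂ t⟩`, and the
    -- pointwise equation in `H₂` can be tested.
    have hr : HalfSpace.root A₂ (w₂ t) = R₂ (A₂ ⟨(w₂ t : H₂), hd⟩) :=
      h₂.root_eq_of_mem_graph s₂ (LinearPMap.mem_graph A₂ ⟨(w₂ t : H₂), hd⟩)
    have hA : A₂ ⟨(w₂ t : H₂), hd⟩ = restrictHalf hCs (v₁ t) - z₂ t := by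
      rw [← sub_eq_zero.1 heq, add_sub_cancel_left]
    rw [form, hr, h₂.inner_root_apply, hA, inner_sub_right, restrictHalfL_apply]
    ring

end CoupledGenerator

/-! ### Existence, uniqueness and bounds for the coupled system -/

section CoupledWellPosed

variable {H₁ H₂ U : Type*}
  [NormedAddCommGroup H₁] [InnerProductSpace ℂ H₁] [CompleteSpace H₁]
  [NormedAddCommGroup H₂] [InnerProductSpace ℂ H₂] [CompleteSpace H₂]
  [NormedAddCommGroup U] [InnerProductSpace ℂ U] [CompleteSpace U]
  {A₁ : H₁ →ₗ.[ℂ] H₁} {A₂ : H₂ →ₗ.[ℂ] H₂} {R₁ : H₁ →L[ℂ] H₁} {R₂ : H₂ →L[ℂ] H₂}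
  {C : H₂ →ₗ.[ℂ] H₁}
  (h₁ : IsRootInverse A₁ R₁) (h₂ : IsRootInverse A₂ R₂) (B : U →L[ℂ] HalfDual A₁)
  (hCs : EmbedsInDomain A₁ C.adjoint) (hC : EmbedsInDomain A₂ C)

include h₁ h₂ in
theorem eqOn_of_isWeakCoupled {T : ℝ} (hT : 0 < T) {p₁ : HalfSpace A₁} {p₂ : HalfSpace A₂}
    {q₁ : H₁} {q₂ : H₂} {w₁ w₁' : ℝ → HalfSpace A₁} {w₂ w₂' : ℝ → HalfSpace A₂} {v₁ v₁' : ℝ → H₁}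
    {v₂ v₂' : ℝ → H₂}
    (w : IsWeakCoupled B (restrictHalf hC) (restrictHalf hCs) T p₁ p₂ q₁ q₂ w₁ w₂ v₁ v₂)
    (w' : IsWeakCoupled B (restrictHalf hC) (restrictHalf hCs) T p₁ p₂ q₁ q₂ w₁' w₂' v₁' v₂') :
    EqOn w₁' w₁ (Icc 0 T) ∧ EqOn w₂' w₂ (Icc 0 T) := by
  have key := (dissipative_coupledInverse h₁ h₂ B hCs hC).eqOn_of_isMild hT
    ((isWeakCoupled_iff h₁ h₂ B hCs hC).1 w').1 ((isWeakCoupled_iff h₁ h₂ B hCs hC).1 w).1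
    (by simp only [w.init₁, w.init₂, w'.init₁, w'.init₂])
  exact ⟨fun t ht => h₁.root_injective (congrArg (fun x : WithLp 2 (WithLp 2 (H₁ × H₂) ×
      WithLp 2 (H₁ × H₂)) => x.fst.fst) (key ht)),
    fun t ht => h₂.root_injective (congrArg (fun x : WithLp 2 (WithLp 2 (H₁ × H₂) ×
      WithLp 2 (H₁ × H₂)) => x.fst.snd) (key ht))⟩

include h₁ h₂ in
theorem exists_isStrongCoupled (s₂ : IsSquareRoot (sqrtOp A₂) A₂) (p₁ : HalfSpace A₁)
    (p₂ : HalfSpace A₂) (q₁ : HalfSpace A₁) (q₂ : HalfSpace A₂)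
    (hp : InGeneratorDomain B p₁ p₂ q₁ q₂) :
    ∃ (w₁ : ℝ → HalfSpace A₁) (w₂ : ℝ → HalfSpace A₂) (v₁ : ℝ → HalfSpace A₁)
      (v₂ : ℝ → HalfSpace A₂) (z₁ : ℝ → H₁) (z₂ : ℝ → H₂), ∀ T,
      IsStrongCoupled B (restrictHalf hC) (restrictHalf hCs) T p₁ p₂ q₁ q₂ w₁ w₂ v₁ v₂ z₁ z₂ := by
  obtain ⟨hp₂, g, hg⟩ := hp
  -- The datum holds the initial velocities and the accelerations dictated by the two equations; `J`
  -- maps it to the prescribed initial state.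
  obtain ⟨u, hu0, -, -, hu⟩ := (dissipative_coupledInverse h₁ h₂ B hCs hC).exists_isMild
    (denseRange_coupledInverse h₁ h₂ B hCs hC) (coupledState q₁ q₂ (-g - restrictHalf hC q₂)
      (restrictHalf hCs q₁ - A₂ ⟨(p₂ : H₂), hp₂⟩))
  have hJ : ∀ x, (coupledInverse h₁ h₂ B hCs hC x).fst.fst =
      -(h₁.damp B x.fst.fst + R₁ (restrictHalf hC (h₂.lift x.fst.snd))) - R₁ x.snd.fst :=
    fun _ => rfl
  have hJ' : ∀ x, (coupledInverse h₁ h₂ B hCs hC x).fst.snd =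
      -(-R₂ (restrictHalf hCs (h₁.lift x.fst.fst))) - R₂ x.snd.snd := fun _ => rfl
  refine ⟨fun t => h₁.lift (coupledInverse h₁ h₂ B hCs hC (u t)).fst.fst,
    fun t => h₂.lift (coupledInverse h₁ h₂ B hCs hC (u t)).fst.snd,
    fun t => h₁.lift (u t).fst.fst, fun t => h₂.lift (u t).fst.snd,
    fun t => (u t).snd.fst, fun t => (u t).snd.snd, fun T => ?_⟩
  have hd := (hu T).hasDerivWithinAt
  have hc := (hu T).cont
  let Y := WithLp 2 (H₁ × H₂)
  refine ⟨⟨fun t ht => hasDerivWithinAt_clm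
        (h₁.lift.comp ((WithLp.fstL 2 ℂ H₁ H₂).comp (WithLp.fstL 2 ℂ Y Y))) (hd t ht),
      (h₁.lift.comp ((WithLp.fstL 2 ℂ H₁ H₂).comp
        (WithLp.fstL 2 ℂ Y Y))).continuous.comp_continuousOn hc⟩,
    ⟨fun t ht => hasDerivWithinAt_clm
        (h₂.lift.comp ((WithLp.sndL 2 ℂ H₁ H₂).comp (WithLp.fstL 2 ℂ Y Y))) (hd t ht),
      (h₂.lift.comp ((WithLp.sndL 2 ℂ H₁ H₂).comp
        (WithLp.fstL 2 ℂ Y Y))).continuous.comp_continuousOn hc⟩,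
    ⟨fun t ht => hasDerivWithinAt_clm
        ((WithLp.fstL 2 ℂ H₁ H₂).comp (WithLp.sndL 2 ℂ Y Y)) (hd t ht),
      ((WithLp.fstL 2 ℂ H₁ H₂).comp
        (WithLp.sndL 2 ℂ Y Y)).continuous.comp_continuousOn hc⟩,
    ⟨fun t ht => hasDerivWithinAt_clm
        ((WithLp.sndL 2 ℂ H₁ H₂).comp (WithLp.sndL 2 ℂ Y Y)) (hd t ht),
      ((WithLp.sndL 2 ℂ H₁ H₂).comp
        (WithLp.sndL 2 ℂ Y Y)).continuous.comp_continuousOn hc⟩,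
    ⟨h₁.root_injective ?_, ?_⟩, ⟨h₂.root_injective ?_, ?_⟩, fun t ht φ => ?_, fun t ht => ?_⟩
  · simp only [h₁.root_lift, hJ, hu0, coupledState, WithLp.toLp_fst, WithLp.toLp_snd,
      h₂.lift_root]
    refine ext_inner_left ℂ fun f => ?_
    have := hg (h₁.lift f)
    rw [← h₁.inner_damp, form, h₁.root_lift, h₁.incl_lift, h₁.symm] at this
    rw [map_sub, map_neg, inner_sub_right, inner_sub_right, inner_neg_right, inner_neg_right,
      inner_add_right, ← this]
    ring
  · simp only [hu0, coupledState, WithLp.toLp_fst, h₁.lift_root]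
  · simp only [h₂.root_lift, hJ', hu0, coupledState, WithLp.toLp_fst, WithLp.toLp_snd,
      h₁.lift_root]
    rw [h₂.root_eq_of_mem_graph s₂ (LinearPMap.mem_graph A₂ ⟨(p₂ : H₂), hp₂⟩), map_sub]
    abel
  · simp only [hu0, coupledState, WithLp.toLp_fst, WithLp.toLp_snd, h₂.lift_root]
  · rw [← h₁.inner_damp, form, h₁.root_lift, h₁.root_lift, ← h₁.inner_root_apply,
      ← h₁.inner_root_apply, hJ, inner_sub_right, inner_neg_right, inner_add_right]
    ring
  -- The second row of `J` expresses `A₂^{1/2} w₂` as `A₂^{-1/2}` of a vector of `H₂`, which puts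
  -- `w₂` in `D(A₂)` and identifies `A₂ w₂`.
  · have hm : (HalfSpace.incl A₂ (h₂.lift (coupledInverse h₁ h₂ B hCs hC (u t)).fst.snd),
        restrictHalf hCs (h₁.lift (u t).fst.fst) - (u t).snd.snd) ∈ A₂.graph := by
      rw [h₂.mem_graph_sq s₂, h₂.incl_lift, hJ', neg_neg, ← map_sub]
    obtain ⟨x, hx1, hx2⟩ := A₂.mem_graph_iff.1 hm
    simp only at hx1 hx2
    refine ⟨hx1 ▸ x.2, ?_⟩
    rw [show (⟨_, hx1 ▸ x.2⟩ : A₂.domain) = x from Subtype.ext hx1.symm, hx2]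
    abel

include h₁ h₂ in
theorem exists_isWeakCoupled (p₁ : HalfSpace A₁) (p₂ : HalfSpace A₂) (q₁ : H₁) (q₂ : H₂) :
    ∃ (w₁ : ℝ → HalfSpace A₁) (w₂ : ℝ → HalfSpace A₂) (v₁ : ℝ → H₁) (v₂ : ℝ → H₂), ∀ T > 0,
      IsWeakCoupled B (restrictHalf hC) (restrictHalf hCs) T p₁ p₂ q₁ q₂ w₁ w₂ v₁ v₂ ∧
      InH1 T (fun t => dualAdjoint B (w₁ t)) := by
  have hr := denseRange_coupledInverse h₁ h₂ B hCs hC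
  obtain ⟨u, hu0, -, -, hu⟩ := (dissipative_coupledInverse h₁ h₂ B hCs hC).exists_isMild hr
    (coupledState p₁ p₂ q₁ q₂)
  refine ⟨fun t => h₁.lift (u t).fst.fst, fun t => h₂.lift (u t).fst.snd,
    fun t => (u t).snd.fst, fun t => (u t).snd.snd, fun T hT => ⟨?_,
    (hu T).inH1 (re_inner_coupledInverse h₁ h₂ B hCs hC) hr hT⟩⟩
  rw [isWeakCoupled_iff h₁ h₂ B hCs hC]
  simp only [coupledState, h₁.root_lift, h₂.root_lift, hu0, WithLp.toLp_fst, WithLp.toLp_snd,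
    h₁.lift_root, h₂.lift_root, and_true]
  exact hu T

include h₁ h₂ in
theorem norm_le_of_isWeakCoupled {T : ℝ} (hT : 0 < T) {p₁ : HalfSpace A₁} {p₂ : HalfSpace A₂}
    {q₁ : H₁} {q₂ : H₂} {w₁ : ℝ → HalfSpace A₁} {w₂ : ℝ → HalfSpace A₂} {v₁ : ℝ → H₁}
    {v₂ : ℝ → H₂}
    (w : IsWeakCoupled B (restrictHalf hC) (restrictHalf hCs) T p₁ p₂ q₁ q₂ w₁ w₂ v₁ v₂)
    {t : ℝ} (ht : t ∈ Icc 0 T) :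
    ‖w₁ t‖ + ‖w₂ t‖ + ‖v₁ t‖ + ‖v₂ t‖ ≤ 4 * (‖p₁‖ + ‖p₂‖ + ‖q₁‖ + ‖q₂‖) := by
  have h := (dissipative_coupledInverse h₁ h₂ B hCs hC).norm_le_of_isMild
    (denseRange_coupledInverse h₁ h₂ B hCs hC) hT ((isWeakCoupled_iff h₁ h₂ B hCs hC).1 w).1 t ht
  rw [w.init₁.1, w.init₁.2, w.init₂.1, w.init₂.2] at h
  have a1 := norm_toLp_le (WithLp.toLp 2 (HalfSpace.root A₁ p₁, HalfSpace.root A₂ p₂))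
    (WithLp.toLp 2 (q₁, q₂))
  have a2 := norm_toLp_le (HalfSpace.root A₁ p₁) (HalfSpace.root A₂ p₂)
  have a3 := norm_toLp_le q₁ q₂
  let Y := WithLp 2 (H₁ × H₂)
  let x := coupledState (w₁ t) (w₂ t) (v₁ t) (v₂ t)
  have b1 : ‖x.fst‖ ≤ ‖x‖ := WithLp.norm_fst_le Y x
  have b2 : ‖x.snd‖ ≤ ‖x‖ := WithLp.norm_snd_le Y x
  have c1 : ‖w₁ t‖ ≤ ‖x.fst‖ := WithLp.norm_fst_le H₁ x.fst
  have c2 : ‖w₂ t‖ ≤ ‖x.fst‖ := WithLp.norm_snd_le H₁ x.fst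
  have c3 : ‖v₁ t‖ ≤ ‖x.snd‖ := WithLp.norm_fst_le H₁ x.snd
  have c4 : ‖v₂ t‖ ≤ ‖x.snd‖ := WithLp.norm_snd_le H₁ x.snd
  have d : ‖x‖ ≤ ‖p₁‖ + ‖p₂‖ + ‖q₁‖ + ‖q₂‖ := by
    refine h.trans (a1.trans ?_)
    rw [HalfSpace.norm_def, HalfSpace.norm_def]
    linarith
  linarith

end CoupledWellPosed

end CoupledSystem

end

/-! ### The main theorem -/

theorem proposition3p1 {H₁ H₂ U : Type*}
    [NormedAddCommGroup H₁] [InnerProductSpace ℂ H₁] [CompleteSpace H₁]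
    [NormedAddCommGroup H₂] [InnerProductSpace ℂ H₂] [CompleteSpace H₂]
    [NormedAddCommGroup U] [InnerProductSpace ℂ U] [CompleteSpace U]
    (A₁ : H₁ →ₗ.[ℂ] H₁) (A₂ : H₂ →ₗ.[ℂ] H₂)
    (hA₁ : IsPositiveSelfAdjoint A₁) (hA₂ : IsPositiveSelfAdjoint A₂)
    (B : U →L[ℂ] HalfDual A₁) (C : H₂ →ₗ.[ℂ] H₁)
    (hCs : EmbedsInDomain A₁ C.adjoint) (hC : EmbedsInDomain A₂ C) :
    -- the second order system is well-posed in `D(A^{1/2}) × H`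
    (IsPositiveSelfAdjoint (blockOp A₁ A₂ C) ∧
      ∃ 𝓑₀ : U →L[ℂ] HalfDual (blockOp A₁ A₂ C),
        IsColumn B 𝓑₀ ∧
        WaveWellPosed (blockOp A₁ A₂ C) 𝓑₀) ∧
    -- (i) strong solutions of the coupled system
    (∀ (p₁ : HalfSpace A₁) (p₂ : HalfSpace A₂)
      (q₁ : HalfSpace A₁) (q₂ : HalfSpace A₂),
      InGeneratorDomain B p₁ p₂ q₁ q₂ →
      ∃ (w₁ : ℝ → HalfSpace A₁) (w₂ : ℝ → HalfSpace A₂)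
        (v₁ : ℝ → HalfSpace A₁) (v₂ : ℝ → HalfSpace A₂)
        (z₁ : ℝ → H₁) (z₂ : ℝ → H₂), ∀ T > 0,
        IsStrongCoupled B (restrictHalf hC)
          (restrictHalf hCs) T p₁ p₂ q₁ q₂ w₁ w₂ v₁ v₂ z₁ z₂ ∧
        ∀ (w₁' : ℝ → HalfSpace A₁) (w₂' : ℝ → HalfSpace A₂)
          (v₁' : ℝ → HalfSpace A₁) (v₂' : ℝ → HalfSpace A₂)
          (z₁' : ℝ → H₁) (z₂' : ℝ → H₂),
          IsStrongCoupled B (restrictHalf hC)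
            (restrictHalf hCs) T p₁ p₂ q₁ q₂ w₁' w₂' v₁' v₂' z₁' z₂' →
          Set.EqOn w₁' w₁ (Set.Icc 0 T) ∧ Set.EqOn w₂' w₂ (Set.Icc 0 T)) ∧
    -- (ii) weak solutions of the coupled system
    (∀ (p₁ : HalfSpace A₁) (p₂ : HalfSpace A₂)
      (q₁ : H₁) (q₂ : H₂),
      ∃ (w₁ : ℝ → HalfSpace A₁) (w₂ : ℝ → HalfSpace A₂)
        (v₁ : ℝ → H₁) (v₂ : ℝ → H₂), ∀ T > 0,
        IsWeakCoupled B (restrictHalf hC)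
          (restrictHalf hCs) T p₁ p₂ q₁ q₂ w₁ w₂ v₁ v₂ ∧
        InH1 T (fun t => dualAdjoint B (w₁ t)) ∧
        ∀ (w₁' : ℝ → HalfSpace A₁) (w₂' : ℝ → HalfSpace A₂)
          (v₁' : ℝ → H₁) (v₂' : ℝ → H₂),
          IsWeakCoupled B (restrictHalf hC)
            (restrictHalf hCs) T p₁ p₂ q₁ q₂ w₁' w₂' v₁' v₂' →
          Set.EqOn w₁' w₁ (Set.Icc 0 T) ∧ Set.EqOn w₂' w₂ (Set.Icc 0 T)) ∧
    -- continuous dependence on the data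
    (∀ T > 0, ∃ M : ℝ,
      ∀ (p₁ : HalfSpace A₁) (p₂ : HalfSpace A₂) (q₁ : H₁) (q₂ : H₂)
        (w₁ : ℝ → HalfSpace A₁) (w₂ : ℝ → HalfSpace A₂)
        (v₁ : ℝ → H₁) (v₂ : ℝ → H₂),
        IsWeakCoupled B (restrictHalf hC)
          (restrictHalf hCs) T p₁ p₂ q₁ q₂ w₁ w₂ v₁ v₂ →
        ∀ t ∈ Set.Icc 0 T,
          ‖w₁ t‖ + ‖w₂ t‖ + ‖v₁ t‖ + ‖v₂ t‖ ≤ M * (‖p₁‖ + ‖p₂‖ + ‖q₁‖ + ‖q₂‖)) := by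
  -- The graph norm dominates the norm of the space, so the two embeddings supply the lower bounds
  -- that make `A₁^{1/2}` and `A₂^{1/2}` boundedly invertible.
  obtain ⟨c₁, hc₁⟩ := hCs.exists_norm_incl_le
  obtain ⟨c₂, hc₂⟩ := hC.exists_norm_incl_le
  obtain ⟨s₁, R₁, h₁⟩ := exists_isRootInverse_of_coercive c₁ hc₁
  obtain ⟨s₂, R₂, h₂⟩ := exists_isRootInverse_of_coercive c₂ hc₂
  obtain ⟨hpos, R, hR, hRw⟩ := blockOp_isPositiveSelfAdjoint h₁ h₂ hCs hC s₁
  obtain ⟨𝓑₀, hB⟩ := exists_isColumn h₁ hCs hR hRw B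
  refine ⟨⟨hpos, 𝓑₀, hB, hR.waveWellPosed 𝓑₀⟩, fun p₁ p₂ q₁ q₂ hp => ?_,
    fun p₁ p₂ q₁ q₂ => ?_, fun T hT => ⟨4, fun p₁ p₂ q₁ q₂ w₁ w₂ v₁ v₂ w t ht =>
      norm_le_of_isWeakCoupled h₁ h₂ B hCs hC hT w ht⟩⟩
  · obtain ⟨w₁, w₂, v₁, v₂, z₁, z₂, w⟩ := exists_isStrongCoupled h₁ h₂ B hCs hC s₂ p₁ p₂ q₁ q₂ hp
    exact ⟨w₁, w₂, v₁, v₂, z₁, z₂, fun T hT => ⟨w T, fun _ _ _ _ _ _ w' =>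
      eqOn_of_isWeakCoupled h₁ h₂ B hCs hC hT
        (isWeakCoupled_of_isStrongCoupled h₁ h₂ B hCs hC s₂ (w T))
        (isWeakCoupled_of_isStrongCoupled h₁ h₂ B hCs hC s₂ w')⟩⟩
  · obtain ⟨w₁, w₂, v₁, v₂, w⟩ := exists_isWeakCoupled h₁ h₂ B hCs hC p₁ p₂ q₁ q₂
    exact ⟨w₁, w₂, v₁, v₂, fun T hT => ⟨(w T hT).1, (w T hT).2, fun _ _ _ _ w' =>
      eqOn_of_isWeakCoupled h₁ h₂ B hCs hC hT (w T hT).1 w'⟩⟩
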